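/- Click-through-rate model. There are finitely many clients $i$ and webpage slots $s$, and countably many keywords $q$. For each $q$ let $\mathcal M_q$ be a nonempty set of $0$-$1$ matrices $M=(M_{is})$ with at most one $1$ in every row and in every column (the admissible assignments of clients to slots), and let $c_{qis}\in[0,1]$ be click-through rates. In each time slot $t=0,1,2,\dots$ a query for keyword $q$ arrives with probability $\nu_q=\nu\vartheta_q$, where $\nu\in(0,1)$, $\vartheta_q\ge 0$, $\sum_q\vartheta_q=1$, and no query arrives with probability $1-\nu$; the outcomes $\tilde q(t)$ are i.i.d. over time slots. A requirement cycle consists of $N\ge1$ time slots, and client $i$ requires $m_i\ge0$ impressions per cycle on average. Let $\tilde m(k)=(\tilde m_i(k))_i$, $k\ge0$, be i.i.d. random vectors, independent of the queries, with $\tilde m_i(k)=\lceil m_i\rceil$ with probability $m_i-\lfloor m_i\rfloor$ and $\tilde m_i(k)=\lfloor m_i\rfloor$ otherwise. Fix $\epsilon>0$. Online algorithm. The initial credit queue vector $\mathbf Q(0)$ has nonnegative integer entries and is independent of all $\tilde q(t)$ and $\tilde m(k)$. In cycle $k$, every query for a keyword $q$ is answered with a matrix $$\tilde M^*(q,\mathbf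 Q(k))\in\arg\max_{M\in\mathcal M_q}\sum_{i,s}M_{is}\Big(\frac{c_{qis}}{\epsilon}+Q_i(k)\Big),$$ ties being broken by an arbitrary fixed function of $(q,\mathbf Q(k))$. Let $S_i(k)=\sum_{t=kN}^{kN+N-1}\sum_s[\tilde M^*(\tilde q(t),\mathbf Q(k))]_{is}$, with the convention that a time slot without a query contributes $0$, be the number of impressions of client $i$ in cycle $k$, and let $Q_i(k+1)=\max\{Q_i(k)+\tilde m_i(k)-S_i(k),\,0\}$. The Markov chain $\{\mathbf Q(k)\}$ is called stable (positive recurrent) if there is a finite set $B$ of states such that, from every deterministic initial state, the expected value of the first $k\ge1$ with $\mathbf Q(k)\in B$ is finite. Statement. (a) The credit queues are stable whenever there are numbers $p_{qM}\in[0,1]$ ($M\in\mathcal M_q$) with $\sum_{M\in\mathcal M_q}p_{qM}\le1$ for all $q$ and $$N\sum_q\nu_q\sum_{M\in\mathcal M_q}p_{qM}\sum_sM_{is}>m_i\quad\text{for all } i.$$ (b) If the credit queues are stable, then for every client $i$ the following limit exists and satisfies $$\lim_{K\to\infty}E\Big[\frac1K\sum_{k=1}^{K}S_i(k)\Big]\ge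 m_i .$$ In particular, under the condition in (a), the long-run expected average number of impressions of each client per requirement cycle is at least its requirement. -/

import Mathlib

open MeasureTheory ProbabilityTheory Filter Topology
open scoped ENNReal

/-- The outcome of a time slot is `some κ` (a query for keyword `κ`) or `none` (no query); it is a
discrete random variable, so every set of outcomes is measurable. -/
instance optionMeasurableSpace {Kw : Type*} : MeasurableSpace (Option Kw) := ⊤

/-- A 0-1 matrix assigning clients (rows) to webpage slots (columns): every slot is given to at most
one client and every client gets at most one slot. -/
def IsAssignment {ι σ : Type*} [Fintype ι] [Fintype σ] (M : Matrix ι σ ℕ) : Prop :=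
  (∀ i s, M i s = 0 ∨ M i s = 1) ∧ (∀ s, ∑ i, M i s ≤ 1) ∧ (∀ i, ∑ s, M i s ≤ 1)

/-- The parameters of the click-through-rate maximization model, with clients `ι`, webpage slots `σ`
and keywords `Kw`. -/
structure CTRModel (ι σ Kw : Type*) [Fintype ι] [Fintype σ] where
  /-- the admissible assignment matrices for each keyword -/
  admissible : Kw → Finset (Matrix ι σ ℕ)
  admissible_isAssignment : ∀ κ, ∀ M ∈ admissible κ, IsAssignment M
  /-- the click-through rates -/
  c : Kw → ι → σ → ℝ
  c_nonneg : ∀ κ i s, 0 ≤ c κ i s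
  c_le_one : ∀ κ i s, c κ i s ≤ 1
  /-- the probability that a query arrives in a time slot -/
  arrival : ℝ
  arrival_pos : 0 < arrival
  arrival_lt_one : arrival < 1
  /-- the distribution of the keyword of an arriving query -/
  θ : Kw → ℝ
  θ_nonneg : ∀ κ, 0 ≤ θ κ
  θ_hasSum : HasSum θ 1
  /-- the number of time slots in a requirement cycle -/
  N : ℕ
  N_pos : 0 < N
  /-- the average impression requirement of each client per requirement cycle -/
  m : ι → ℝ
  m_nonneg : ∀ i, 0 ≤ m i
  /-- the parameter of the online algorithm -/
  ε : ℝ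
  ε_pos : 0 < ε

namespace CTRModel

variable {ι σ Kw Ω : Type*} [Fintype ι] [Fintype σ] [MeasurableSpace Ω]

/-- The rate of queries for keyword `κ` per time slot. -/
def rate (A : CTRModel ι σ Kw) (κ : Kw) : ℝ := A.arrival * A.θ κ

/-- The average number of impressions of client `i` per requirement cycle when each query for `κ` is
answered by the matrix `M` with probability `p κ M`. -/
noncomputable def avgImpressions (A : CTRModel ι σ Kw) (p : Kw → Matrix ι σ ℕ → ℝ) (i : ι) : ℝ :=
  A.N * ∑' κ, A.rate κ * ∑ M ∈ A.admissible κ, p κ M * ∑ s, (M i s : ℝ)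

/-- `p` is a (sub)probability choice of admissible matrices that gives each client strictly more
impressions per requirement cycle, on average, than it requires. -/
def StrictlyFeasible (A : CTRModel ι σ Kw) (p : Kw → Matrix ι σ ℕ → ℝ) : Prop :=
  (∀ κ, ∀ M ∈ A.admissible κ, 0 ≤ p κ M ∧ p κ M ≤ 1) ∧
  (∀ κ, ∑ M ∈ A.admissible κ, p κ M ≤ 1) ∧
  ∀ i, A.m i < A.avgImpressions p i

/-- The statistical assumptions on the query process `q` (indexed by time slots) and on the integer
requirements `mt` (indexed by requirement cycles): the queries are i.i.d. over time slots; the vectors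
`mt k` are i.i.d. over cycles and independent of the queries; `mt k i` equals `⌈m i⌉` with
probability `m i - ⌊m i⌋` and `⌊m i⌋` otherwise. -/
structure IsInput (A : CTRModel ι σ Kw) (μ : Measure Ω) (q : ℕ → Ω → Option Kw)
    (mt : ℕ → Ω → ι → ℕ) : Prop where
  measurable_q : ∀ t, Measurable (q t)
  prob_some : ∀ t κ, μ {ω | q t ω = some κ} = ENNReal.ofReal (A.rate κ)
  prob_none : ∀ t, μ {ω | q t ω = none} = ENNReal.ofReal (1 - A.arrival)
  indep_q : iIndepFun q μ
  measurable_mt : ∀ k, Measurable (mt k)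
  law_mt : ∀ k i, μ.map (fun ω => mt k ω i) =
    ENNReal.ofReal (A.m i - ⌊A.m i⌋₊) • Measure.dirac ⌈A.m i⌉₊ +
      ENNReal.ofReal (1 - (A.m i - ⌊A.m i⌋₊)) • Measure.dirac ⌊A.m i⌋₊
  identDistrib_mt : ∀ k, IdentDistrib (mt k) (mt 0) μ μ
  indep_mt : iIndepFun mt μ
  indep_q_mt : IndepFun (fun ω t => q t ω) (fun ω k => mt k ω) μ

/-- The objective of the maximization step of the online algorithm, for a query for `κ` when the
queue lengths are `Q`. -/
noncomputable def weight (A : CTRModel ι σ Kw) (κ : Kw) (Q : ι → ℕ) (M : Matrix ι σ ℕ) : ℝ :=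
  ∑ i, ∑ s, (M i s : ℝ) * (A.c κ i s / A.ε + Q i)

/-- `sel κ Q` is, for all `κ` and `Q`, one of the admissible matrices of maximal weight: `sel` is a
way to run the online algorithm, with ties broken in an arbitrary fixed manner. -/
def IsMaxWeightRule (A : CTRModel ι σ Kw) (sel : Kw → (ι → ℕ) → Matrix ι σ ℕ) : Prop :=
  ∀ κ Q, sel κ Q ∈ A.admissible κ ∧ ∀ M ∈ A.admissible κ, A.weight κ Q M ≤ A.weight κ Q (sel κ Q)

/-- The number of impressions of client `i` during requirement cycle `k`, along the query sequence
`q`, if the queue lengths at the beginning of the cycle are `Q`. -/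
def impressions (A : CTRModel ι σ Kw) (sel : Kw → (ι → ℕ) → Matrix ι σ ℕ) (q : ℕ → Option Kw)
    (k : ℕ) (Q : ι → ℕ) (i : ι) : ℕ :=
  ∑ t ∈ Finset.Ico (k * A.N) (k * A.N + A.N),
    match q t with
    | none => 0
    | some κ => ∑ s, sel κ Q i s

/-- The credit queues at the beginning of requirement cycle `k`, started from `Q₀`. Subtraction of
natural numbers is truncated at `0`, so the update is `[Q i + mt i - S i]⁺`. -/
def queue (A : CTRModel ι σ Kw) (sel : Kw → (ι → ℕ) → Matrix ι σ ℕ) (q : ℕ → Option Kw)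
    (mt : ℕ → ι → ℕ) (Q₀ : ι → ℕ) : ℕ → ι → ℕ
  | 0 => Q₀
  | k + 1 => fun i =>
      queue A sel q mt Q₀ k i + mt k i - A.impressions sel q k (queue A sel q mt Q₀ k) i

/-- The first `k ≥ 1` at which the queue vector started from `Q₀` is in `B` (`∞` if there is none). -/
noncomputable def returnTime (A : CTRModel ι σ Kw) (sel : Kw → (ι → ℕ) → Matrix ι σ ℕ)
    (q : ℕ → Option Kw) (mt : ℕ → ι → ℕ) (Q₀ : ι → ℕ) (B : Finset (ι → ℕ)) : ℝ≥0∞ :=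
  ⨅ (k : ℕ) (_ : 1 ≤ k) (_ : A.queue sel q mt Q₀ k ∈ B), (k : ℝ≥0∞)

/-- Stability (positive recurrence) of the Markov chain of credit queues: there is a finite set of
states that the chain, from every initial state, reaches (or returns to) in finite expected time. For
an irreducible chain this is positive recurrence of every state. -/
def Stable (A : CTRModel ι σ Kw) (μ : Measure Ω) (sel : Kw → (ι → ℕ) → Matrix ι σ ℕ)
    (q : ℕ → Ω → Option Kw) (mt : ℕ → Ω → ι → ℕ) : Prop :=
  ∃ B : Finset (ι → ℕ), ∀ x : ι → ℕ,
    ∫⁻ ω, A.returnTime sel (fun t => q t ω) (fun k => mt k ω) x B ∂μ < ∞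

/-- The number of impressions of client `i` in requirement cycle `k` when the online algorithm is run
from the (random) initial queue lengths `Q₀`. -/
def cycleImpressions (A : CTRModel ι σ Kw) (sel : Kw → (ι → ℕ) → Matrix ι σ ℕ)
    (q : ℕ → Ω → Option Kw) (mt : ℕ → Ω → ι → ℕ) (Q₀ : Ω → ι → ℕ) (k : ℕ) (i : ι) (ω : Ω) : ℕ :=
  A.impressions sel (fun t => q t ω) k
    (A.queue sel (fun t => q t ω) (fun j => mt j ω) (Q₀ ω) k) i

end CTRModel

/-!
If the requirements are strictly feasible, the max-weight rule makes the squared norm of the queue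
vector decrease in expectation outside a finite set, and Foster's criterion gives stability.

Now let the chain be stable. Decomposing according to the last visit to the recurrent finite set `B`
shows that the laws of the queue vectors form a tight family: the excursions from the finitely many
states of `B` have finite expected length. Tightness is total boundedness of the orbit of the
initial law in `ℓ¹`, so the mean ergodic theorem makes the averages of the laws converge in `ℓ¹`,
with no irreducibility or aperiodicity assumption. Hence the average numbers of impressions
converge. Finally, the requirements up to cycle `K` are either served or still in the queue, and a
tight queue holds only `o(K)` of them in expectation.
-/

section MeanErgodic

variable {E : Type*} [NormedAddCommGroup E] [NormedSpace ℝ E]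

lemma map_birkhoffAverage_self (T : E →L[ℝ] E) (n : ℕ) (x : E) :
    T (birkhoffAverage ℝ T id n x) = birkhoffAverage ℝ T id n (T x) := by
  rw [map_birkhoffAverage ℝ ℝ T]
  simp only [birkhoffAverage, birkhoffSum, Function.comp_apply, id, ← Function.iterate_succ_apply,
    Function.iterate_succ_apply']

lemma sub_birkhoffAverage_mem_range (T : E →L[ℝ] E) {n : ℕ} (hn : n ≠ 0) (x : E) :
    x - birkhoffAverage ℝ T id n x ∈ (T - 1).range := by
  have hiter : ∀ k, x - T^[k] x ∈ (T - 1).range := by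
    intro k
    induction k with
    | zero => simp
    | succ k ih =>
      have : x - T^[k + 1] x = (x - T^[k] x) - (T - 1) (T^[k] x) := by
        simp [Function.iterate_succ_apply']
      exact this ▸ sub_mem ih ⟨_, rfl⟩
  have havg : x - birkhoffAverage ℝ T id n x
      = (n : ℝ)⁻¹ • ∑ k ∈ Finset.range n, (x - T^[k] x) := by
    simp [birkhoffAverage, birkhoffSum, smul_sub, ← Nat.cast_smul_eq_nsmul ℝ, smul_smul, hn]
  exact havg ▸ Submodule.smul_mem _ _ (Submodule.sum_mem _ fun k _ => hiter k)

lemma isBounded_range_iterate {T : E →L[ℝ] E} (hT : ‖T‖ ≤ 1) (x : E) :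
    Bornology.IsBounded (Set.range fun n => T^[n] x) := by
  refine isBounded_iff_forall_norm_le.2 ⟨‖x‖, Set.forall_mem_range.2 fun n => ?_⟩
  simpa [iterate_map_zero] using ((T.lipschitz.weaken (K' := 1) hT).iterate n).dist_le_mul x 0

lemma tendsto_birkhoffAverage_of_mem_closure_range {T : E →L[ℝ] E} (hT : ‖T‖ ≤ 1) {x : E}
    (hx : x ∈ closure ((T - 1).range : Set E)) :
    Tendsto (birkhoffAverage ℝ T id · x) atTop (𝓝 0) := by
  have hclosed : IsClosed {x | Tendsto (birkhoffAverage ℝ T id · x) atTop (𝓝 0)} :=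
    isClosed_setOfPred_tendsto_birkhoffAverage ℝ (T.lipschitz.weaken hT) uniformContinuous_id
      continuous_const
  refine closure_minimal (Set.forall_mem_range.2 fun y => ?_) hclosed hx
  have h := tendsto_birkhoffAverage_apply_sub_birkhoffAverage ℝ (g := id)
    (isBounded_range_iterate hT y)
  simpa [birkhoffAverage, birkhoffSum, Finset.sum_sub_distrib, smul_sub, iterate_map_sub] using h

theorem exists_tendsto_birkhoffAverage_of_totallyBounded [CompleteSpace E] {T : E →L[ℝ] E}
    (hT : ‖T‖ ≤ 1) {x : E} (hx : TotallyBounded (Set.range fun n => T^[n] x)) :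
    ∃ y, Tendsto (birkhoffAverage ℝ T id · x) atTop (𝓝 y) := by
  have hmem : ∀ᶠ n in atTop, birkhoffAverage ℝ T id n x
      ∈ closure (convexHull ℝ (Set.range fun n => T^[n] x)) := by
    filter_upwards [eventually_ne_atTop 0] with n hn
    refine subset_closure ?_
    rw [birkhoffAverage, birkhoffSum, Finset.smul_sum]
    exact (convex_convexHull ℝ _).sum_mem (fun _ _ => by positivity) (by simp [hn])
      fun k _ => subset_convexHull ℝ _ ⟨k, rfl⟩
  have hcompact : IsCompact (closure (convexHull ℝ (Set.range fun n => T^[n] x))) :=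
    hx.convexHull.closure.isCompact_of_isClosed isClosed_closure
  obtain ⟨y, -, φ, hφ, hy⟩ := hcompact.tendsto_subseq' hmem.frequently
  have hfix : T y = y := by
    have hdiff := tendsto_birkhoffAverage_apply_sub_birkhoffAverage ℝ (g := id)
      (isBounded_range_iterate hT x)
    simp only [← map_birkhoffAverage_self] at hdiff
    exact sub_eq_zero.1 (tendsto_nhds_unique
      (((T.continuous.tendsto y).comp hy).sub hy) (hdiff.comp hφ.tendsto_atTop))
  have hsub : x - y ∈ closure ((T - 1).range : Set E) :=
    mem_closure_of_tendsto (hy.const_sub x) <|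
      (hφ.tendsto_atTop.eventually_ne_atTop 0).mono fun n hn =>
        sub_birkhoffAverage_mem_range T hn x
  refine ⟨y, ?_⟩
  simpa [birkhoffAverage, birkhoffSum, Finset.sum_sub_distrib, smul_sub, iterate_map_sub] using
    (tendsto_birkhoffAverage_of_mem_closure_range hT hsub).add
      (Function.IsFixedPt.tendsto_birkhoffAverage ℝ hfix id)

end MeanErgodic

section PointMass

open scoped lp

variable {X E : Type*} [NormedAddCommGroup E] [NormedSpace ℝ E] [CompleteSpace E]

lemma summable_lp_one_smul (u : ℓ¹(X, ℝ)) {f : X → E} {C : ℝ} (hf : ∀ x, ‖f x‖ ≤ C) :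
    Summable fun x => u x • f x := by
  have hu : Summable fun x => ‖u x‖ := by simpa using u.2.summable
  refine .of_norm_bounded (hu.mul_right C) fun x => ?_
  exact (norm_smul_le _ _).trans (mul_le_mul_of_nonneg_left (hf x) (norm_nonneg _))

/-- The continuous linear map `u ↦ ∑ x, u x • f x` on `ℓ¹` given by a bounded family `f`. It is the
integration of `f` against a measure when `u` is the vector of point masses of the measure. -/
noncomputable def lpOneSMulCLM (f : X → E) {C : ℝ} (hf : ∀ x, ‖f x‖ ≤ C) : ℓ¹(X, ℝ) →L[ℝ] E :=
  LinearMap.mkContinuous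
    { toFun := fun u => ∑' x, u x • f x
      map_add' := fun u v => by
        simp only [lp.coeFn_add, Pi.add_apply, add_smul]
        exact (summable_lp_one_smul u hf).tsum_add (summable_lp_one_smul v hf)
      map_smul' := fun c u => by
        simp only [lp.coeFn_smul, Pi.smul_apply, smul_assoc, RingHom.id_apply]
        exact (summable_lp_one_smul u hf).tsum_const_smul c }
    C fun u => by
      have hu : HasSum (fun x => ‖u x‖) ‖u‖ := by simpa using lp.hasSum_norm (by simp) u
      rw [mul_comm]
      refine tsum_of_norm_bounded (hu.mul_right C) fun x => ?_
      exact (norm_smul_le _ _).trans (mul_le_mul_of_nonneg_left (hf x) (norm_nonneg _))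

lemma norm_lpOneSMulCLM_le (f : X → E) {C : ℝ} (hC : 0 ≤ C) (hf : ∀ x, ‖f x‖ ≤ C) :
    ‖lpOneSMulCLM f hf‖ ≤ C :=
  LinearMap.mkContinuous_norm_le _ hC _

variable [MeasurableSpace X] [MeasurableSingletonClass X]

/-- The point masses of a finite measure, as a vector of `ℓ¹`. -/
noncomputable def pointMass (ν : Measure X) [IsFiniteMeasure ν] : ℓ¹(X, ℝ) :=
  ⟨fun x => ν.real {x}, memℓp_gen' (C := ν.real Set.univ) fun F => by
    simpa [abs_of_nonneg measureReal_nonneg, sum_measureReal_singleton] using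
      measureReal_mono (μ := ν) (Set.subset_univ (F : Set X))⟩

lemma pointMass_apply (ν : Measure X) [IsFiniteMeasure ν] (x : X) : pointMass ν x = ν.real {x} :=
  rfl

lemma norm_pointMass_le (ν : Measure X) [IsFiniteMeasure ν] : ‖pointMass ν‖ ≤ ν.real Set.univ :=
  lp.norm_le_of_forall_sum_le (by simp) measureReal_nonneg fun F => by
    simpa [pointMass_apply, abs_of_nonneg measureReal_nonneg, sum_measureReal_singleton] using
      measureReal_mono (μ := ν) (Set.subset_univ (F : Set X))

lemma norm_pointMass_le_one (ν : Measure X) [IsProbabilityMeasure ν] : ‖pointMass ν‖ ≤ 1 :=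
  (norm_pointMass_le ν).trans_eq probReal_univ

lemma pointMass_add (ν ν' : Measure X) [IsFiniteMeasure ν] [IsFiniteMeasure ν'] :
    pointMass (ν + ν') = pointMass ν + pointMass ν' :=
  lp.ext <| funext fun _ => measureReal_add_apply

lemma dist_pointMass_restrict_le (ν : Measure X) [IsFiniteMeasure ν] {s : Set X}
    (hs : MeasurableSet s) : dist (pointMass ν) (pointMass (ν.restrict s)) ≤ ν.real sᶜ := by
  have hsplit : pointMass ν = pointMass (ν.restrict s) + pointMass (ν.restrict sᶜ) := by
    rw [← pointMass_add]
    congr 1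
    exact (Measure.restrict_add_restrict_compl hs).symm
  rw [dist_eq_norm, hsplit, add_sub_cancel_left]
  simpa using norm_pointMass_le (ν.restrict sᶜ)

lemma pointMass_restrict_finset [DecidableEq X] (ν : Measure X) [IsFiniteMeasure ν] (F : Finset X) :
    pointMass (ν.restrict F) = ∑ x ∈ F, lp.single 1 x (ν.real {x}) := by
  ext y
  rw [lp.coeFn_sum, Finset.sum_apply]
  by_cases hy : y ∈ F <;>
    simp [pointMass_apply, measureReal_restrict_apply, hy, lp.single_apply, Pi.single_apply]

section Countable

variable [Countable X]

lemma lpOneSMulCLM_pointMass {f : X → E} {C : ℝ} (hf : ∀ x, ‖f x‖ ≤ C) (ν : Measure X)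
    [IsFiniteMeasure ν] : lpOneSMulCLM f hf (pointMass ν) = ∫ x, f x ∂ν := by
  rw [integral_countable]
  · rfl
  · exact .of_bound StronglyMeasurable.of_discrete.aestronglyMeasurable C (ae_of_all _ hf)

lemma pointMass_bind (ν : Measure X) [IsFiniteMeasure ν] (κ : Kernel X X) [IsMarkovKernel κ] :
    pointMass (ν.bind κ) = lpOneSMulCLM (fun x => pointMass (κ x))
      (fun x => norm_pointMass_le_one (κ x)) (pointMass ν) := by
  ext y
  have hκ : ∀ x, ‖(κ x).real {y}‖ ≤ 1 := fun x => by
    simp [abs_of_nonneg measureReal_nonneg]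
  have hbind : pointMass (ν.bind κ) y = ∫ x, (κ x).real {y} ∂ν := by
    rw [pointMass_apply, measureReal_def,
      Measure.bind_apply (measurableSet_singleton y) κ.aemeasurable]
    exact (integral_toReal (κ.measurable_coe (measurableSet_singleton y)).aemeasurable
      (ae_of_all _ fun x => measure_lt_top _ _)).symm
  rw [hbind, ← lpOneSMulCLM_pointMass hκ]
  exact ((lp.evalCLM ℝ (fun _ : X => ℝ) 1 y).map_tsum
    (summable_lp_one_smul (pointMass ν) fun x => norm_pointMass_le_one (κ x))).symm

end Countable

variable {J : Type*}

lemma totallyBounded_range_pointMass_restrict (law : J → Measure X)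
    [∀ j, IsProbabilityMeasure (law j)] (F : Finset X) :
    TotallyBounded (Set.range fun j => pointMass ((law j).restrict F)) := by
  classical
  have hcont : Continuous fun w : X → ℝ => ∑ x ∈ F, lp.single 1 x (w x) :=
    continuous_finsetSum _ fun x _ =>
      (lp.isometry_single x).continuous.comp (continuous_apply x)
  refine ((isCompact_Icc (a := (0 : X → ℝ)) (b := 1)).image hcont).totallyBounded.subset ?_
  rintro _ ⟨j, rfl⟩
  exact ⟨fun x => (law j).real {x}, ⟨fun x => measureReal_nonneg, fun x => measureReal_le_one⟩,
    (pointMass_restrict_finset _ F).symm⟩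

lemma totallyBounded_range_pointMass [TopologicalSpace X] [DiscreteTopology X]
    {law : J → Measure X} [∀ j, IsProbabilityMeasure (law j)]
    (h : IsTightMeasureSet (Set.range law)) :
    TotallyBounded (Set.range fun j => pointMass (law j)) := by
  rw [Metric.totallyBounded_iff]
  intro ε hε
  obtain ⟨K, hK, hlaw⟩ := isTightMeasureSet_iff_exists_isCompact_measure_compl_le.1 h
    (ENNReal.ofReal (ε / 2)) (by simpa using hε)
  obtain ⟨F, rfl⟩ := hK.finite_of_discrete.exists_finset_coe
  obtain ⟨t, ht, hcover⟩ := Metric.totallyBounded_iff.1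
    (totallyBounded_range_pointMass_restrict law F) (ε / 2) (half_pos hε)
  refine ⟨t, ht, ?_⟩
  rintro _ ⟨j, rfl⟩
  obtain ⟨u, hu, hdist⟩ := Set.mem_iUnion₂.1 (hcover ⟨j, rfl⟩)
  refine Set.mem_iUnion₂.2 ⟨u, hu, ?_⟩
  have htail : dist (pointMass (law j)) (pointMass ((law j).restrict F)) ≤ ε / 2 :=
    (dist_pointMass_restrict_le _ F.measurableSet).trans
      (ENNReal.toReal_le_of_le_ofReal (half_pos hε).le (hlaw _ ⟨j, rfl⟩))
  calc dist (pointMass (law j)) u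
      ≤ dist (pointMass (law j)) (pointMass ((law j).restrict F))
        + dist (pointMass ((law j).restrict F)) u := dist_triangle _ _ _
    _ < ε / 2 + ε / 2 := add_lt_add_of_le_of_lt htail hdist
    _ = ε := add_halves ε

end PointMass

theorem exists_tendsto_average_integral {X : Type*} [Countable X] [MeasurableSpace X]
    [MeasurableSingletonClass X] [TopologicalSpace X] [DiscreteTopology X] (κ : Kernel X X)
    [IsMarkovKernel κ] {law : ℕ → Measure X} [∀ k, IsProbabilityMeasure (law k)]
    (hstep : ∀ k, law (k + 1) = (law k).bind κ) (htight : IsTightMeasureSet (Set.range law))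
    {f : X → ℝ} {C : ℝ} (hf : ∀ x, ‖f x‖ ≤ C) :
    ∃ l, Tendsto (fun n : ℕ => (n : ℝ)⁻¹ * ∑ k ∈ Finset.range n, ∫ x, f x ∂law k) atTop (𝓝 l) := by
  set T := lpOneSMulCLM (fun x => pointMass (κ x)) fun x => norm_pointMass_le_one (κ x)
  have hiter : ∀ k, T^[k] (pointMass (law 0)) = pointMass (law k) := by
    intro k
    induction k with
    | zero => rfl
    | succ k ih =>
      rw [Function.iterate_succ_apply', ih, ← pointMass_bind]
      simp only [hstep]
  have horbit : TotallyBounded (Set.range fun k => T^[k] (pointMass (law 0))) := by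
    simpa only [hiter] using totallyBounded_range_pointMass htight
  obtain ⟨u, hu⟩ : ∃ u, Tendsto (birkhoffAverage ℝ T id · (pointMass (law 0))) atTop (𝓝 u) :=
    exists_tendsto_birkhoffAverage_of_totallyBounded (norm_lpOneSMulCLM_le _ zero_le_one _) horbit
  refine ⟨lpOneSMulCLM f hf u, ?_⟩
  have h := ((lpOneSMulCLM f hf).continuous.tendsto u).comp hu
  simpa [Function.comp_def, birkhoffAverage, birkhoffSum, hiter, lpOneSMulCLM_pointMass] using h

lemma tendsto_lintegral_zero_of_dominated {α J : Type*} [MeasurableSpace α] {ν : Measure α}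
    {L : Filter J} [L.IsCountablyGenerated] {f : J → α → ℝ≥0∞} (bound : α → ℝ≥0∞)
    (hmeas : ∀ j, Measurable (f j)) (hle : ∀ j, f j ≤ bound) (hbound : ∫⁻ a, bound a ∂ν ≠ ∞)
    (hlim : ∀ a, Tendsto (fun j => f j a) L (𝓝 0)) :
    Tendsto (fun j => ∫⁻ a, f j a ∂ν) L (𝓝 0) := by
  simpa using tendsto_lintegral_filter_of_dominated_convergence (f := fun _ => 0) bound
    (Eventually.of_forall hmeas) (Eventually.of_forall fun j => ae_of_all _ (hle j)) hbound
    (ae_of_all _ hlim)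

section Taboo

variable {X : Type*} [MeasurableSpace X]

/-- The transition operator of the Markov chain with kernel `κ` that is killed when it enters `B`:
`(tabooOp κ B)^[n] 1 x` is the probability that the chain started at `x` avoids `B` at the times
`1, …, n`. -/
noncomputable def tabooOp (κ : Kernel X X) (B : Set X) (f : X → ℝ≥0∞) (x : X) : ℝ≥0∞ :=
  ∫⁻ y in Bᶜ, f y ∂κ x

/-- The expected first time `n ≥ 1` at which the Markov chain with kernel `κ` started at `x` is in
`B`, as the sum over `n` of the probabilities that this time is larger than `n`. -/
noncomputable def meanReturnTime (κ : Kernel X X) (B : Set X) (x : X) : ℝ≥0∞ :=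
  ∑' n, (tabooOp κ B)^[n] 1 x

lemma tabooOp_mono (κ : Kernel X X) (B : Set X) : Monotone (tabooOp κ B) :=
  fun _ _ h _ => lintegral_mono h

lemma tabooOp_iterate_one_le_one (κ : Kernel X X) [IsMarkovKernel κ] (B : Set X) (n : ℕ) :
    (tabooOp κ B)^[n] 1 ≤ 1 := by
  induction n with
  | zero => exact le_rfl
  | succ n ih =>
    rw [Function.iterate_succ_apply']
    refine (tabooOp_mono κ B ih).trans fun x => ?_
    simp only [tabooOp, Pi.one_apply, lintegral_one, Measure.restrict_apply_univ]
    exact prob_le_one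

variable {κ : Kernel X X} [IsMarkovKernel κ]

lemma measurable_tabooOp_iterate {B : Set X} (hB : MeasurableSet B) {f : X → ℝ≥0∞}
    (hf : Measurable f) (n : ℕ) : Measurable ((tabooOp κ B)^[n] f) := by
  induction n with
  | zero => exact hf
  | succ n ih =>
    rw [Function.iterate_succ_apply']
    exact ih.setLIntegral_kernel hB.compl

lemma sum_range_succ_tabooOp_iterate_one {B : Set X} (hB : MeasurableSet B) (n : ℕ) (x : X) :
    ∑ i ∈ Finset.range (n + 1), (tabooOp κ B)^[i] 1 x
      = tabooOp κ B (fun y => ∑ i ∈ Finset.range n, (tabooOp κ B)^[i] 1 y) x + 1 := by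
  simp only [Finset.sum_range_succ', Function.iterate_succ_apply', Function.iterate_zero_apply,
    Pi.one_apply, tabooOp]
  rw [lintegral_finsetSum _ fun i _ => measurable_tabooOp_iterate hB measurable_one i]

theorem meanReturnTime_ne_top_of_foster_drift {B : Set X} (hB : MeasurableSet B) {V : X → ℝ≥0∞}
    (hV : ∀ x, ∫⁻ y, V y ∂κ x ≠ ∞) (hdrift : ∀ x ∉ B, ∫⁻ y, V y ∂κ x + 1 ≤ V x) (x : X) :
    meanReturnTime κ B x ≠ ∞ := by
  have hstep : ∀ n, (∀ y ∉ B, ∑ i ∈ Finset.range n, (tabooOp κ B)^[i] 1 y ≤ V y) →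
      ∀ x, ∑ i ∈ Finset.range (n + 1), (tabooOp κ B)^[i] 1 x ≤ ∫⁻ y, V y ∂κ x + 1 := by
    intro n hn x
    rw [sum_range_succ_tabooOp_iterate_one hB]
    gcongr
    exact (setLIntegral_mono' hB.compl hn).trans (setLIntegral_le_lintegral _ _)
  have houtside : ∀ n, ∀ y ∉ B, ∑ i ∈ Finset.range n, (tabooOp κ B)^[i] 1 y ≤ V y := by
    intro n
    induction n with
    | zero => simp
    | succ n ih => exact fun y hy => (hstep n ih y).trans (hdrift y hy)
  refine ne_top_of_le_ne_top (ENNReal.add_ne_top.2 ⟨hV x, ENNReal.one_ne_top⟩)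
    (ENNReal.tsum_le_of_sum_range_le fun n => ?_)
  exact (Finset.sum_le_sum_of_subset (Finset.range_mono n.le_succ)).trans
    (hstep n (houtside n) x)

section Dominated

variable {J : Type*} {L : Filter J} [L.IsCountablyGenerated] {f : J → X → ℝ≥0∞}
  (hmeas : ∀ j, Measurable (f j)) (hle : ∀ j, f j ≤ 1)
  (hlim : ∀ x, Tendsto (fun j => f j x) L (𝓝 0))
include hmeas hle hlim

lemma tendsto_tabooOp_iterate_zero {B : Set X} (hB : MeasurableSet B) (n : ℕ) (x : X) :
    Tendsto (fun j => (tabooOp κ B)^[n] (f j) x) L (𝓝 0) := by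
  induction n generalizing x with
  | zero => exact hlim x
  | succ n ih =>
    simp only [Function.iterate_succ_apply']
    exact tendsto_lintegral_zero_of_dominated 1
      (fun j => measurable_tabooOp_iterate hB (hmeas j) n)
      (fun j => ((tabooOp_mono κ B).iterate n (hle j)).trans (tabooOp_iterate_one_le_one κ B n))
      (by simp) ih

lemma tendsto_tsum_tabooOp_iterate_zero {B : Set X} (hB : MeasurableSet B) {x : X}
    (hx : meanReturnTime κ B x ≠ ∞) :
    Tendsto (fun j => ∑' n, (tabooOp κ B)^[n] (f j) x) L (𝓝 0) := by
  simp only [← lintegral_count]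
  exact tendsto_lintegral_zero_of_dominated (fun n => (tabooOp κ B)^[n] 1 x)
    (fun _ => .of_discrete) (fun j n => (tabooOp_mono κ B).iterate n (hle j) x)
    (by rwa [lintegral_count]) fun n => tendsto_tabooOp_iterate_zero hmeas hle hlim hB n x

end Dominated

lemma tendsto_lintegral_tabooOp_iterate_one {B : Set X} (hB : MeasurableSet B)
    (hreturn : ∀ x, meanReturnTime κ B x ≠ ∞) (ν : Measure X) [IsFiniteMeasure ν] :
    Tendsto (fun n => ∫⁻ x, (tabooOp κ B)^[n] 1 x ∂ν) atTop (𝓝 0) :=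
  tendsto_lintegral_zero_of_dominated 1 (measurable_tabooOp_iterate hB measurable_one)
    (tabooOp_iterate_one_le_one κ B) (by simp)
    fun x => ENNReal.tendsto_atTop_zero_of_tsum_ne_top (hreturn x)

section FiniteTarget

variable [MeasurableSingletonClass X]

lemma lintegral_le_tabooOp_add_sum (B : Finset X) (f : X → ℝ≥0∞) (x : X) :
    ∫⁻ y, f y ∂κ x ≤ tabooOp κ B f x + ∑ b ∈ B, f b := by
  rw [← lintegral_add_compl f (A := (B : Set X)) B.measurableSet, add_comm, lintegral_finset]
  exact add_le_add le_rfl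
    (Finset.sum_le_sum fun b _ => mul_le_of_le_one_right' prob_le_one)

variable {law : ℕ → Measure X} [∀ k, IsProbabilityMeasure (law k)]
  (hstep : ∀ k, law (k + 1) = (law k).bind κ)
include hstep

/-- Decompose according to the last visit to `B`. -/
lemma lintegral_law_le (B : Finset X) {f : X → ℝ≥0∞} (hf : Measurable f) (k : ℕ) :
    ∫⁻ x, f x ∂law k ≤ ∫⁻ x, (tabooOp κ B)^[k] f x ∂law 0
      + ∑ n ∈ Finset.range k, ∑ b ∈ B, (tabooOp κ B)^[n] f b := by
  induction k generalizing f with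
  | zero => simp
  | succ k ih =>
    calc ∫⁻ x, f x ∂law (k + 1) = ∫⁻ x, ∫⁻ y, f y ∂κ x ∂law k := by
          rw [hstep, Measure.lintegral_bind κ.aemeasurable hf.aemeasurable]
      _ ≤ ∫⁻ x, (tabooOp κ B f x + ∑ b ∈ B, f b) ∂law k :=
          lintegral_mono fun x => lintegral_le_tabooOp_add_sum B f x
      _ = ∫⁻ x, tabooOp κ B f x ∂law k + ∑ b ∈ B, f b := by
          rw [lintegral_add_right _ measurable_const]; simp
      _ ≤ _ := by
          rw [Finset.sum_range_succ', ← add_assoc]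
          simpa only [Function.iterate_succ_apply, Function.iterate_zero_apply] using
            add_le_add_left (ih (measurable_tabooOp_iterate B.measurableSet hf 1)) _

/-- Uniformity in the time `k` comes from the last-exit decomposition: what happened before the last
visit to `B` is forgotten, and the excursions after it are summable. -/
theorem tendsto_iSup_lintegral_law_zero {B : Finset X} (hreturn : ∀ x, meanReturnTime κ B x ≠ ∞)
    {J : Type*} {L : Filter J} [L.IsCountablyGenerated] {f : J → X → ℝ≥0∞}
    (hmeas : ∀ j, Measurable (f j)) (hle : ∀ j, f j ≤ 1)
    (hlim : ∀ x, Tendsto (fun j => f j x) L (𝓝 0)) :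
    Tendsto (fun j => ⨆ k, ∫⁻ x, f j x ∂law k) L (𝓝 0) := by
  set T := tabooOp κ (B : Set X)
  refine ENNReal.tendsto_nhds_zero.2 fun ε hε => ?_
  obtain ⟨k₀, hk₀⟩ := ((tendsto_lintegral_tabooOp_iterate_one B.measurableSet hreturn
    (law 0)).eventually_le_const (ENNReal.half_pos hε.ne')).exists_forall_of_atTop
  have hearly : ∀ᶠ j in L, ∀ k ∈ Finset.range k₀, ∫⁻ x, f j x ∂law k ≤ ε :=
    (Finset.eventually_all _).2 fun k _ =>
      (tendsto_lintegral_zero_of_dominated 1 hmeas hle (by simp) hlim).eventually_le_const hε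
  have hexcursion : Tendsto (fun j => ∑ b ∈ B, ∑' n, T^[n] (f j) b) L (𝓝 0) := by
    simpa using tendsto_finsetSum B fun b _ =>
      tendsto_tsum_tabooOp_iterate_zero hmeas hle hlim B.measurableSet (hreturn b)
  filter_upwards [hearly, hexcursion.eventually_le_const (ENNReal.half_pos hε.ne')] with j hj hsum
  refine iSup_le fun k => ?_
  rcases lt_or_ge k k₀ with hk | hk
  · exact hj k (Finset.mem_range.2 hk)
  calc ∫⁻ x, f j x ∂law k
      ≤ ∫⁻ x, T^[k] (f j) x ∂law 0 + ∑ n ∈ Finset.range k, ∑ b ∈ B, T^[n] (f j) b :=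
        lintegral_law_le hstep B (hmeas j) k
    _ ≤ ∫⁻ x, T^[k] 1 x ∂law 0 + ∑ b ∈ B, ∑' n, T^[n] (f j) b := by
        rw [Finset.sum_comm]
        gcongr with x b
        · exact (tabooOp_mono κ B).iterate k (hle j) x
        · exact ENNReal.sum_le_tsum _
    _ ≤ ε / 2 + ε / 2 := add_le_add (hk₀ k hk) hsum
    _ = ε := ENNReal.add_halves ε

theorem isTightMeasureSet_range_law [Countable X] [TopologicalSpace X] {B : Finset X}
    (hreturn : ∀ x, meanReturnTime κ B x ≠ ∞) : IsTightMeasureSet (Set.range law) := by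
  have hlim : ∀ x, Tendsto (fun F : Finset X => (F : Set X)ᶜ.indicator (1 : X → ℝ≥0∞) x) atTop
      (𝓝 0) := fun x => tendsto_const_nhds.congr' <|
    (eventually_ge_atTop {x}).mono fun F hF => by simp [Finset.singleton_subset_iff.1 hF]
  have htail := tendsto_iSup_lintegral_law_zero hstep hreturn
    (fun F : Finset X => measurable_one.indicator F.measurableSet.compl)
    (fun F => Set.indicator_le_self _ _) hlim
  refine isTightMeasureSet_iff_exists_isCompact_measure_compl_le.2 fun ε hε => ?_
  obtain ⟨F, hF⟩ := (htail.eventually_le_const hε).exists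
  refine ⟨F, F.finite_toSet.isCompact, ?_⟩
  rintro _ ⟨k, rfl⟩
  rw [← lintegral_indicator_one F.measurableSet.compl]
  exact (le_iSup (fun k => ∫⁻ x, (F : Set X)ᶜ.indicator 1 x ∂law k) k).trans hF

end FiniteTarget

end Taboo

lemma iInf_mem_natCast_eq_tsum (S : Set ℕ) :
    (⨅ k ∈ S, (k : ℝ≥0∞)) = ∑' n, {n | ∀ k ∈ S, n < k}.indicator 1 n := by
  rcases S.eq_empty_or_nonempty with rfl | hS
  · simp [ENNReal.tsum_const_eq_top_of_ne_zero one_ne_zero]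
  have hleast : IsLeast S (sInf S) := ⟨Nat.sInf_mem hS, fun _ => Nat.sInf_le⟩
  have hbelow : {n | ∀ k ∈ S, n < k} = Finset.range (sInf S) := by
    ext n
    simpa using ⟨fun h => h _ hleast.1, fun h k hk => h.trans_le (hleast.2 hk)⟩
  have htsum : ∑' n, {n | ∀ k ∈ S, n < k}.indicator (1 : ℕ → ℝ≥0∞) n = (sInf S : ℕ) := by
    rw [hbelow, ← sum_eq_tsum_indicator]
    simp
  rw [htsum]
  exact le_antisymm (iInf₂_le _ hleast.1)
    (le_iInf₂ fun k hk => by exact_mod_cast hleast.2 hk)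

section RandomRecursion

variable {Ω X E : Type*} {m : MeasurableSpace Ω} [mΩ : MeasurableSpace Ω] [MeasurableSpace X]
  [MeasurableSpace E]

lemma lintegral_indicator_comp_of_indep {μ : Measure Ω} [IsProbabilityMeasure μ] (hm : m ≤ mΩ)
    {D : Set Ω} (hD : MeasurableSet[m] D) {Y : Ω → X} (hY : Measurable[m] Y) {ξ : Ω → E}
    (hξ : Measurable ξ) (hind : Indep m (MeasurableSpace.comap ξ inferInstance) μ)
    {G : X → E → ℝ≥0∞} (hG : Measurable (Function.uncurry G)) :
    ∫⁻ ω, D.indicator (fun ω => G (Y ω) (ξ ω)) ω ∂μ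
      = ∫⁻ ω, D.indicator (fun ω => ∫⁻ e, G (Y ω) e ∂μ.map ξ) ω ∂μ := by
  have : IsProbabilityMeasure (μ.map ξ) := Measure.isProbabilityMeasure_map hξ.aemeasurable
  have hDY : Measurable[m] fun ω => (D.indicator (1 : Ω → ℝ≥0∞) ω, Y ω) :=
    ((@measurable_one _ _ _ m _).indicator hD).prodMk hY
  have hDY' : Measurable fun ω => (D.indicator (1 : Ω → ℝ≥0∞) ω, Y ω) := hDY.mono hm le_rfl
  have hDYξ : IndepFun (fun ω => (D.indicator (1 : Ω → ℝ≥0∞) ω, Y ω)) ξ μ :=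
    indep_of_indep_of_le_left hind hDY.comap_le
  have hmul : Measurable fun p : (ℝ≥0∞ × X) × E => p.1.1 * G p.1.2 p.2 :=
    measurable_fst.fst.mul (hG.comp (measurable_fst.snd.prodMk measurable_snd))
  have hsplit (g : Ω → ℝ≥0∞) (ω : Ω) : D.indicator g ω = D.indicator 1 ω * g ω := by
    by_cases hω : ω ∈ D <;> simp [hω]
  simp only [hsplit fun ω => G (Y ω) (ξ ω), hsplit fun ω => ∫⁻ e, G (Y ω) e ∂μ.map ξ]
  rw [← lintegral_map (f := fun p : (ℝ≥0∞ × X) × E => p.1.1 * G p.1.2 p.2) hmul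
    (hDY'.prodMk hξ), hDYξ.map_prod_eq_prod_map_map hDY'.aemeasurable hξ.aemeasurable,
    lintegral_prod _ hmul.aemeasurable, lintegral_map hmul.lintegral_prod_right' hDY']
  refine lintegral_congr fun ω => lintegral_const_mul _ ?_
  exact hG.comp measurable_prodMk_left

/-- The Markov kernel of the random recursion `x ↦ Φ x e` whose noise `e` has law `ν`. It is
zero if `ν` is not s-finite. -/
noncomputable def recursionKernel {Φ : X → E → X} (_ : Measurable (Function.uncurry Φ))
    (ν : Measure E) : Kernel X X :=
  (Kernel.id ×ₖ Kernel.const X ν).map (Function.uncurry Φ)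

instance isMarkovKernel_recursionKernel {Φ : X → E → X} (hΦ : Measurable (Function.uncurry Φ))
    (ν : Measure E) [IsProbabilityMeasure ν] : IsMarkovKernel (recursionKernel hΦ ν) :=
  Kernel.IsMarkovKernel.map _ hΦ

lemma lintegral_recursionKernel {Φ : X → E → X} (hΦ : Measurable (Function.uncurry Φ))
    (ν : Measure E) [SFinite ν] {f : X → ℝ≥0∞} (hf : Measurable f) (x : X) :
    ∫⁻ y, f y ∂recursionKernel hΦ ν x = ∫⁻ e, f (Φ x e) ∂ν := by
  rw [recursionKernel, Kernel.lintegral_map _ hΦ _ hf]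
  exact Kernel.lintegral_id_prod (f := fun p => f (Function.uncurry Φ p)) (hf.comp hΦ) _ _

/-- `Y` is a Markov chain driven by i.i.d. noise: `Y (k + 1) = Φ (Y k) (ξ k)`, where the noise `ξ k`
has law `ν` and is independent of the past `ℱ k`, to which `Y k` belongs. -/
structure IsRandomRecursion (μ : Measure Ω) (ℱ : Filtration ℕ mΩ) (Φ : X → E → X) (ν : Measure E)
    (Y : ℕ → Ω → X) (ξ : ℕ → Ω → E) : Prop where
  measurable_state : ∀ k, Measurable[ℱ k] (Y k)
  measurable_noise : ∀ k, Measurable (ξ k)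
  indep_noise : ∀ k, Indep (ℱ k) (MeasurableSpace.comap (ξ k) inferInstance) μ
  map_noise : ∀ k, μ.map (ξ k) = ν
  state_succ : ∀ k ω, Y (k + 1) ω = Φ (Y k ω) (ξ k ω)

namespace IsRandomRecursion

variable {μ : Measure Ω} {ℱ : Filtration ℕ mΩ} {Φ : X → E → X} {ν : Measure E} {Y : ℕ → Ω → X}
  {ξ : ℕ → Ω → E}

lemma measurable (h : IsRandomRecursion μ ℱ Φ ν Y ξ) (k : ℕ) : Measurable (Y k) :=
  (h.measurable_state k).mono (ℱ.le k) le_rfl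

variable [IsProbabilityMeasure μ]

lemma map_prodMk (h : IsRandomRecursion μ ℱ Φ ν Y ξ) (k : ℕ) :
    μ.map (fun ω => (Y k ω, ξ k ω)) = (μ.map (Y k)).prod ν := by
  have hind : IndepFun (Y k) (ξ k) μ :=
    indep_of_indep_of_le_left (h.indep_noise k) (h.measurable_state k).comap_le
  rw [hind.map_prod_eq_prod_map_map (h.measurable k).aemeasurable
    (h.measurable_noise k).aemeasurable, h.map_noise]

lemma map_succ [SFinite ν] (h : IsRandomRecursion μ ℱ Φ ν Y ξ)
    (hΦ : Measurable (Function.uncurry Φ)) (k : ℕ) :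
    μ.map (Y (k + 1)) = (μ.map (Y k)).bind (recursionKernel hΦ ν) := by
  have hsucc : μ.map (Y (k + 1)) = ((μ.map (Y k)).prod ν).map (Function.uncurry Φ) := by
    rw [← h.map_prodMk, Measure.map_map hΦ ((h.measurable k).prodMk (h.measurable_noise k))]
    exact congrArg μ.map (funext (h.state_succ k))
  refine Measure.ext_of_lintegral _ fun f hf => ?_
  have hfΦ : Measurable fun p => f (Function.uncurry Φ p) := hf.comp hΦ
  rw [Measure.lintegral_bind (Kernel.aemeasurable _) hf.aemeasurable, hsucc, lintegral_map hf hΦ,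
    lintegral_prod _ hfΦ.aemeasurable]
  simp only [lintegral_recursionKernel hΦ ν hf, Function.uncurry_apply_pair]

lemma lintegral_indicator_avoid [IsProbabilityMeasure ν] (h : IsRandomRecursion μ ℱ Φ ν Y ξ)
    (hΦ : Measurable (Function.uncurry Φ)) {x : X} (hx : ∀ ω, Y 0 ω = x) {B : Set X}
    (hB : MeasurableSet B) (n : ℕ) {f : X → ℝ≥0∞} (hf : Measurable f) :
    ∫⁻ ω, {ω | ∀ j ∈ Finset.Icc 1 n, Y j ω ∉ B}.indicator (fun ω => f (Y n ω)) ω ∂μ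
      = (tabooOp (recursionKernel hΦ ν) B)^[n] f x := by
  induction n generalizing f with
  | zero => simp [hx]
  | succ n ih =>
    have hfB : Measurable (Bᶜ.indicator f) := hf.indicator hB.compl
    have hD : MeasurableSet[ℱ n] {ω | ∀ j ∈ Finset.Icc 1 n, Y j ω ∉ B} := by
      simp only [Set.ofPred_forall]
      exact .biInter (Finset.countable_toSet _) fun j hj =>
        ((h.measurable_state j).mono (ℱ.mono (Finset.mem_Icc.1 hj).2) le_rfl) hB.compl
    have hinter : {ω | ∀ j ∈ Finset.Icc 1 (n + 1), Y j ω ∉ B}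
        = {ω | ∀ j ∈ Finset.Icc 1 n, Y j ω ∉ B} ∩ Y (n + 1) ⁻¹' Bᶜ := by
      ext ω
      simp [← Finset.insert_Icc_right_eq_Icc_add_one (show 1 ≤ n + 1 by omega), and_comm]
    have hsplit (ω : Ω) : (Y (n + 1) ⁻¹' Bᶜ).indicator (fun ω => f (Y (n + 1) ω)) ω
        = Bᶜ.indicator f (Φ (Y n ω) (ξ n ω)) := by
      rw [← h.state_succ]
      rfl
    rw [Function.iterate_succ_apply, ← ih]
    · simp only [hinter, ← Set.indicator_indicator, funext hsplit]
      rw [lintegral_indicator_comp_of_indep (ℱ.le n) hD (h.measurable_state n)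
        (h.measurable_noise n) (h.indep_noise n) (G := fun x e => Bᶜ.indicator f (Φ x e))
        (hfB.comp hΦ), h.map_noise]
      simp only [tabooOp, ← lintegral_indicator hB.compl, lintegral_recursionKernel hΦ ν hfB]
    · exact hf.setLIntegral_kernel hB.compl

theorem lintegral_returnTime [IsProbabilityMeasure ν] (h : IsRandomRecursion μ ℱ Φ ν Y ξ)
    (hΦ : Measurable (Function.uncurry Φ)) {x : X} (hx : ∀ ω, Y 0 ω = x) {B : Set X}
    (hB : MeasurableSet B) :
    ∫⁻ ω, ⨅ (k : ℕ) (_ : 1 ≤ k) (_ : Y k ω ∈ B), (k : ℝ≥0∞) ∂μ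
      = meanReturnTime (recursionKernel hΦ ν) B x := by
  have htsum (ω : Ω) : (⨅ (k : ℕ) (_ : 1 ≤ k) (_ : Y k ω ∈ B), (k : ℝ≥0∞))
      = ∑' n, {ω | ∀ j ∈ Finset.Icc 1 n, Y j ω ∉ B}.indicator 1 ω := by
    classical
    have hmem (n : ℕ) : (∀ k, 1 ≤ k → Y k ω ∈ B → n < k) ↔ ∀ j, 1 ≤ j → j ≤ n → Y j ω ∉ B := by
      simp only [← not_le]
      exact forall_congr' fun k => forall_congr' fun _ => imp_not_comm
    simpa [iInf_and, Set.indicator_apply, hmem] using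
      iInf_mem_natCast_eq_tsum {k | 1 ≤ k ∧ Y k ω ∈ B}
  have hD (n : ℕ) : MeasurableSet {ω | ∀ j ∈ Finset.Icc 1 n, Y j ω ∉ B} := by
    simp only [Set.ofPred_forall]
    exact .biInter (Finset.countable_toSet _) fun j _ => h.measurable j hB.compl
  simp only [htsum]
  rw [lintegral_tsum fun n => (measurable_one.indicator (hD n)).aemeasurable, meanReturnTime]
  exact tsum_congr fun n => h.lintegral_indicator_avoid hΦ hx hB n measurable_one

end IsRandomRecursion

end RandomRecursion

section Sources

variable {Ω I J : Type*} {mΩ : MeasurableSpace Ω} {μ : Measure Ω} {m : I → MeasurableSpace Ω}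

lemma iIndep_sumElim {m' : J → MeasurableSpace Ω} (h : iIndep m μ) (h' : iIndep m' μ)
    (hind : Indep (⨆ i, m i) (⨆ j, m' j) μ) : iIndep (Sum.elim m m') μ := by
  rw [iIndep_iff]
  intro s f hf
  have hleft : ∀ i ∈ s.toLeft, MeasurableSet[m i] (f (Sum.inl i)) :=
    fun i hi => hf _ (Finset.mem_toLeft.1 hi)
  have hright : ∀ j ∈ s.toRight, MeasurableSet[m' j] (f (Sum.inr j)) :=
    fun j hj => hf _ (Finset.mem_toRight.1 hj)
  have hinter : ⋂ x ∈ s, f x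
      = (⋂ i ∈ s.toLeft, f (Sum.inl i)) ∩ ⋂ j ∈ s.toRight, f (Sum.inr j) := by
    ext ω
    simp
  rw [hinter, (Indep_iff _ _ μ).1 hind _ _
      (s.toLeft.measurableSet_biInter fun i hi => le_iSup m i _ (hleft i hi))
      (s.toRight.measurableSet_biInter fun j hj => le_iSup m' j _ (hright j hj)),
    h.meas_biInter hleft, h'.meas_biInter hright]
  nth_rw 3 [← Finset.toLeft_disjSum_toRight (u := s)]
  rw [Finset.prod_disjSum]

/-- The filtration generated by sources of randomness `m i`, where `m i` is revealed at the
time `τ i`. -/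
def sourceFiltration (hm : ∀ i, m i ≤ mΩ) (τ : I → ℕ) : Filtration ℕ mΩ where
  seq k := ⨆ i ∈ {i | τ i ≤ k}, m i
  mono' _ _ hkl := biSup_mono fun _ hi => hi.trans hkl
  le' _ := iSup₂_le fun i _ => hm i

lemma le_sourceFiltration (hm : ∀ i, m i ≤ mΩ) {τ : I → ℕ} {i : I} {k : ℕ} (hi : τ i ≤ k) :
    m i ≤ sourceFiltration hm τ k :=
  le_biSup m (show i ∈ {i | τ i ≤ k} from hi)

lemma indep_sourceFiltration (hm : ∀ i, m i ≤ mΩ) (h : iIndep m μ) (τ : I → ℕ) (k : ℕ) :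
    Indep (sourceFiltration hm τ k) (⨆ i ∈ {i | τ i = k + 1}, m i) μ :=
  indep_iSup_of_disjoint hm h (Set.disjoint_left.2 fun i (hle : τ i ≤ k) (heq : τ i = k + 1) => by
    omega)

end Sources

lemma integrable_natCast_of_ae_le {Ω : Type*} [MeasurableSpace Ω] {μ : Measure Ω}
    [IsFiniteMeasure μ] {f : Ω → ℕ} {C : ℕ} (hf : Measurable f) (hC : ∀ᵐ ω ∂μ, f ω ≤ C) :
    Integrable (fun ω => (f ω : ℝ)) μ :=
  .of_bound (measurable_from_top.comp hf).aestronglyMeasurable C <| by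
    filter_upwards [hC] with ω hω
    simpa using hω

section TightAverages

variable {Ω : Type*} [MeasurableSpace Ω] {μ : Measure Ω}

lemma integral_min_le [IsProbabilityMeasure μ] {f : Ω → ℕ} (hf : Measurable f) (R M : ℕ) :
    ∫ ω, ((min (f ω) M : ℕ) : ℝ) ∂μ ≤ R + M * μ.real {ω | R < f ω} := by
  have hset : MeasurableSet {ω | R < f ω} := hf (measurableSet_Ioi (a := R))
  have hind : Integrable ({ω | R < f ω}.indicator fun _ => (M : ℝ)) μ :=
    (integrable_const _).indicator hset
  calc ∫ ω, ((min (f ω) M : ℕ) : ℝ) ∂μ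
      ≤ ∫ ω, (R : ℝ) + {ω | R < f ω}.indicator (fun _ => (M : ℝ)) ω ∂μ := by
        refine integral_mono (integrable_natCast_of_ae_le (hf.min measurable_const)
          (ae_of_all _ fun ω => min_le_right _ _)) ((integrable_const _).add hind) fun ω => ?_
        by_cases hω : R < f ω
        · have hmin : min (f ω) M ≤ R + M := (min_le_right _ _).trans (Nat.le_add_left _ _)
          simpa only [Set.indicator, Set.mem_ofPred_eq, hω, if_true, Nat.cast_add] using
            Nat.cast_le (α := ℝ).2 hmin
        · have hmin : min (f ω) M ≤ R := (min_le_left _ _).trans (not_lt.1 hω)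
          simpa only [Set.indicator, Set.mem_ofPred_eq, hω, if_false, add_zero] using
            Nat.cast_le (α := ℝ).2 hmin
    _ = R + M * μ.real {ω | R < f ω} := by
        rw [integral_add (integrable_const _) hind, integral_indicator_const _ hset]
        simp [mul_comm]

variable {Y : ℕ → Ω → ℕ}

lemma exists_measureReal_lt_le (hY : ∀ k, Measurable (Y k))
    (htight : IsTightMeasureSet (Set.range fun k => μ.map (Y k))) {δ : ℝ} (hδ : 0 < δ) :
    ∃ R : ℕ, ∀ k, μ.real {ω | R < Y k ω} ≤ δ := by
  obtain ⟨S, hS, hle⟩ := isTightMeasureSet_iff_exists_isCompact_measure_compl_le.1 htight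
    (ENNReal.ofReal δ) (ENNReal.ofReal_pos.2 hδ)
  obtain ⟨R, hR⟩ := hS.bddAbove
  refine ⟨R, fun k => ENNReal.toReal_le_of_le_ofReal hδ.le ?_⟩
  calc μ {ω | R < Y k ω} ≤ μ (Y k ⁻¹' Sᶜ) :=
        measure_mono fun ω (hω : R < Y k ω) hmem => hω.not_ge (hR hmem)
    _ = μ.map (Y k) Sᶜ := (Measure.map_apply (hY k) (.of_discrete)).symm
    _ ≤ ENNReal.ofReal δ := hle _ ⟨k, rfl⟩

lemma tendsto_inv_mul_integral_min [IsProbabilityMeasure μ] (hY : ∀ k, Measurable (Y k))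
    (htight : IsTightMeasureSet (Set.range fun k => μ.map (Y k))) (D : ℕ) :
    Tendsto (fun n : ℕ => (n : ℝ)⁻¹ * ∫ ω, ((min (Y n ω) (n * D) : ℕ) : ℝ) ∂μ) atTop (𝓝 0) := by
  refine tendsto_order.2 ⟨fun a ha => .of_forall fun n => ha.trans_le (by positivity),
    fun a ha => ?_⟩
  obtain ⟨R, hR⟩ := exists_measureReal_lt_le hY htight (δ := a / (2 * (D + 1))) (by positivity)
  have hlim : ∀ᶠ n : ℕ in atTop, (R : ℝ) / n < a / 2 :=
    (tendsto_const_div_atTop_nhds_zero_nat (R : ℝ)).eventually_lt_const (by positivity)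
  filter_upwards [hlim, eventually_gt_atTop 0] with n hn hpos
  have : (0 : ℝ) < n := Nat.cast_pos.2 hpos
  calc (n : ℝ)⁻¹ * ∫ ω, ((min (Y n ω) (n * D) : ℕ) : ℝ) ∂μ
      ≤ (n : ℝ)⁻¹ * (R + (n * D : ℕ) * (a / (2 * (D + 1)))) := by
        gcongr
        exact (integral_min_le (hY n) R _).trans (by gcongr; exact hR n)
    _ = R / n + a / 2 * (D / (D + 1)) := by
        push_cast
        field_simp
    _ ≤ R / n + a / 2 := by
        gcongr
        exact mul_le_of_le_one_right (by positivity)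
          (div_le_one_of_le₀ (by linarith) (by positivity))
    _ < a := by linarith

end TightAverages

lemma sq_tsub_le {x m s D N : ℕ} (hm : m ≤ D) (hs : s ≤ N) :
    ((x + m - s : ℕ) : ℝ) ^ 2 ≤ (x : ℝ) ^ 2 + 2 * x * ((m : ℝ) - s) + ((D : ℝ) + N) ^ 2 := by
  have hm' : (m : ℝ) ≤ D := by exact_mod_cast hm
  have hs' : (s : ℝ) ≤ N := by exact_mod_cast hs
  have hsq : ((m : ℝ) - s) ^ 2 ≤ ((D : ℝ) + N) ^ 2 :=
    sq_le_sq' (by linarith [Nat.cast_nonneg (α := ℝ) m]) (by linarith [Nat.cast_nonneg (α := ℝ) s])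
  have htsub : ((x + m - s : ℕ) : ℝ) ^ 2 ≤ ((x : ℝ) + m - s) ^ 2 := by
    rcases le_total s (x + m) with h | h
    · rw [Nat.cast_sub h, Nat.cast_add]
    · rw [Nat.sub_eq_zero_of_le h, Nat.cast_zero, zero_pow two_ne_zero]
      positivity
  linarith [htsub, show ((x : ℝ) + m - s) ^ 2 = x ^ 2 + 2 * x * (m - s) + (m - s) ^ 2 by ring]

namespace CTRModel

section Dynamics

variable {ι σ Kw Ω : Type*} [Fintype ι] [Fintype σ] (A : CTRModel ι σ Kw)
  (sel : Kw → (ι → ℕ) → Matrix ι σ ℕ)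

/-- `sel` answers every query with an admissible matrix. -/
def IsAdmissibleRule : Prop := ∀ κ x, sel κ x ∈ A.admissible κ

variable {A sel} in
lemma IsMaxWeightRule.isAdmissibleRule (h : A.IsMaxWeightRule sel) : A.IsAdmissibleRule sel :=
  fun κ x => (h κ x).1

/-- The number of impressions of client `i` in a time slot with outcome `o` when the queue lengths
are `x`. -/
def slotImpressions (x : ι → ℕ) (i : ι) (o : Option Kw) : ℕ := o.elim 0 fun κ => ∑ s, sel κ x i s

/-- The number of impressions of client `i` over `n` time slots with outcomes `u` during which the
queue lengths are `x`. -/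
def blockImpressions {n : ℕ} (x : ι → ℕ) (i : ι) (u : Fin n → Option Kw) : ℕ :=
  ∑ j, slotImpressions sel x i (u j)

/-- The queue lengths after a cycle with query outcomes `e.1` and requirements `e.2`. -/
def cycleStep {n : ℕ} (x : ι → ℕ) (e : (Fin n → Option Kw) × (ι → ℕ)) : ι → ℕ :=
  fun i => x i + e.2 i - blockImpressions sel x i e.1

/-- The query outcomes and the requirements of cycle `k`. -/
def cycleNoise (q : ℕ → Ω → Option Kw) (mt : ℕ → Ω → ι → ℕ) (k : ℕ) (ω : Ω) :
    (Fin A.N → Option Kw) × (ι → ℕ) :=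
  (fun j => q (k * A.N + j) ω, mt k ω)

/-- The queue lengths at the beginning of cycle `k`, started from the random queue lengths `Q₀`. -/
def creditQueue (q : ℕ → Ω → Option Kw) (mt : ℕ → Ω → ι → ℕ) (Q₀ : Ω → ι → ℕ) (k : ℕ) (ω : Ω) :
    ι → ℕ :=
  A.queue sel (fun t => q t ω) (fun j => mt j ω) (Q₀ ω) k

variable {A sel}

lemma impressions_eq_blockImpressions (q : ℕ → Option Kw) (k : ℕ) (x : ι → ℕ) (i : ι) :
    A.impressions sel q k x i
      = blockImpressions sel x i fun j : Fin A.N => q (k * A.N + j) := by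
  rw [impressions, Finset.sum_Ico_eq_sum_range, Nat.add_sub_cancel_left, Finset.sum_range]
  refine Finset.sum_congr rfl fun j _ => ?_
  dsimp only
  cases q (k * A.N + j) <;> rfl

lemma cycleImpressions_eq_blockImpressions (q : ℕ → Ω → Option Kw) (mt : ℕ → Ω → ι → ℕ)
    (Q₀ : Ω → ι → ℕ) (k : ℕ) (i : ι) (ω : Ω) :
    A.cycleImpressions sel q mt Q₀ k i ω
      = blockImpressions sel (A.creditQueue sel q mt Q₀ k ω) i (A.cycleNoise q mt k ω).1 :=
  impressions_eq_blockImpressions _ _ _ _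

lemma creditQueue_succ (q : ℕ → Ω → Option Kw) (mt : ℕ → Ω → ι → ℕ) (Q₀ : Ω → ι → ℕ) (k : ℕ)
    (ω : Ω) :
    A.creditQueue sel q mt Q₀ (k + 1) ω
      = cycleStep sel (A.creditQueue sel q mt Q₀ k ω) (A.cycleNoise q mt k ω) := by
  funext i
  simp only [creditQueue, queue, impressions_eq_blockImpressions]
  rfl

lemma slotImpressions_le_one (hsel : A.IsAdmissibleRule sel) (x : ι → ℕ) (i : ι) (o : Option Kw) :
    slotImpressions sel x i o ≤ 1 := by
  cases o with
  | none => exact zero_le_one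
  | some κ => exact (A.admissible_isAssignment κ _ (hsel κ x)).2.2 i

lemma blockImpressions_le (hsel : A.IsAdmissibleRule sel) {n : ℕ} (x : ι → ℕ) (i : ι)
    (u : Fin n → Option Kw) : blockImpressions sel x i u ≤ n :=
  (Finset.sum_le_sum fun j _ => slotImpressions_le_one hsel x i (u j)).trans (by simp)

end Dynamics

lemma measurable_uncurry_cycleStep {ι σ Kw : Type*} [Finite ι] [Fintype σ] [Countable Kw] {n : ℕ}
    {sel : Kw → (ι → ℕ) → Matrix ι σ ℕ} : Measurable (Function.uncurry (cycleStep sel (n := n))) :=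
  Measurable.of_discrete

section Input

variable {ι σ Kw Ω : Type*} [Fintype ι] [Fintype σ] {A : CTRModel ι σ Kw}
  {q : ℕ → Ω → Option Kw} {mt : ℕ → Ω → ι → ℕ}
  {sel : Kw → (ι → ℕ) → Matrix ι σ ℕ} {Q₀ : Ω → ι → ℕ}

/-- The sources of randomness: the initial queue lengths, the query of each time slot, the
requirements of each cycle. -/
@[reducible] def source (q : ℕ → Ω → Option Kw) (mt : ℕ → Ω → ι → ℕ) (Q₀ : Ω → ι → ℕ) :
    Unit ⊕ (ℕ ⊕ ℕ) → MeasurableSpace Ω :=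
  Sum.elim (fun _ => .comap Q₀ inferInstance)
    (Sum.elim (fun t => .comap (q t) inferInstance) fun k => .comap (mt k) inferInstance)

/-- The number of the cycle at the beginning of which a source of randomness has become known. -/
def sourceTime (A : CTRModel ι σ Kw) : Unit ⊕ (ℕ ⊕ ℕ) → ℕ :=
  Sum.elim (fun _ => 0) (Sum.elim (fun t => t / A.N + 1) fun k => k + 1)

lemma comap_cycleNoise_le (k : ℕ) :
    MeasurableSpace.comap (A.cycleNoise q mt k) inferInstance
      ≤ ⨆ s ∈ {s | A.sourceTime s = k + 1}, source q mt Q₀ s := by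
  have hle {s} (hs : A.sourceTime s = k + 1) :
      source q mt Q₀ s ≤ ⨆ s ∈ {s | A.sourceTime s = k + 1}, source q mt Q₀ s :=
    le_biSup (source q mt Q₀) (show s ∈ {s | A.sourceTime s = k + 1} from hs)
  rw [← measurable_iff_comap_le]
  refine Measurable.prodMk (@measurable_pi_lambda _ _ _ (_) _ _ fun j => ?_) ?_
  · refine (comap_measurable (q (k * A.N + j))).mono
      (hle (s := .inr (.inl (k * A.N + j))) ?_) le_rfl
    simp [sourceTime, Nat.add_div_of_dvd_right (Dvd.intro_left k rfl), Nat.div_eq_of_lt j.2,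
      A.N_pos]
  · exact (comap_measurable (mt k)).mono (hle (s := .inr (.inr k)) rfl) le_rfl

variable [MeasurableSpace Ω] {μ : Measure Ω}

namespace IsInput

lemma source_le (hin : A.IsInput μ q mt) (hQ₀ : Measurable Q₀) (s : Unit ⊕ (ℕ ⊕ ℕ)) :
    source q mt Q₀ s ≤ ‹MeasurableSpace Ω› := by
  rcases s with _ | t | k
  exacts [hQ₀.comap_le, (hin.measurable_q t).comap_le, (hin.measurable_mt k).comap_le]

lemma iIndep_source [IsProbabilityMeasure μ] (hin : A.IsInput μ q mt)
    (hind : IndepFun Q₀ (fun ω => ((fun t => q t ω), (fun k => mt k ω))) μ) :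
    iIndep (source q mt Q₀) μ := by
  refine iIndep_sumElim .of_subsingleton (iIndep_sumElim hin.indep_q hin.indep_mt ?_) ?_
  · simpa only [IndepFun_iff_Indep, MeasurableSpace.comap_process_pi] using hin.indep_q_mt
  · refine indep_of_indep_of_le_left (indep_of_indep_of_le_right hind ?_) (iSup_le fun _ => le_rfl)
    have hinput : Measurable[MeasurableSpace.comap
        (fun ω => ((fun t => q t ω), fun k => mt k ω)) inferInstance]
        (fun ω => ((fun t => q t ω), fun k => mt k ω)) := comap_measurable _
    refine iSup_le fun s => ?_
    rcases s with t | k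
    · exact ((measurable_pi_apply t).comp (measurable_fst.comp hinput)).comap_le
    · exact ((measurable_pi_apply k).comp (measurable_snd.comp hinput)).comap_le

lemma measurable_cycleNoise (hin : A.IsInput μ q mt) (k : ℕ) : Measurable (A.cycleNoise q mt k) :=
  (measurable_pi_lambda _ fun _ => hin.measurable_q _).prodMk (hin.measurable_mt k)

variable [Countable Kw]

lemma map_q (hin : A.IsInput μ q mt) (t : ℕ) : μ.map (q t) = μ.map (q 0) := by
  refine Measure.ext_of_singleton fun o => ?_
  rw [Measure.map_apply (hin.measurable_q _) (measurableSet_singleton _),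
    Measure.map_apply (hin.measurable_q _) (measurableSet_singleton _)]
  cases o with
  | none => exact (hin.prob_none t).trans (hin.prob_none 0).symm
  | some κ => exact (hin.prob_some t κ).trans (hin.prob_some 0 κ).symm

variable [IsProbabilityMeasure μ]

lemma map_cycleNoise (hin : A.IsInput μ q mt) (k : ℕ) :
    μ.map (A.cycleNoise q mt k)
      = (Measure.pi fun _ : Fin A.N => μ.map (q 0)).prod (μ.map (mt 0)) := by
  have hind : IndepFun (fun ω (j : Fin A.N) => q (k * A.N + j) ω) (mt k) μ :=
    hin.indep_q_mt.comp (φ := fun (u : ℕ → Option Kw) (j : Fin A.N) => u (k * A.N + j))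
      (ψ := fun (u : ℕ → ι → ℕ) => u k) (by fun_prop) (by fun_prop)
  have hiind : iIndepFun (fun j : Fin A.N => q (k * A.N + j)) μ :=
    hin.indep_q.precomp fun a b h => Fin.ext (by simpa using h)
  have hblock := (iIndepFun_iff_map_fun_eq_pi_map fun j : Fin A.N =>
    (hin.measurable_q (k * A.N + j)).aemeasurable).1 hiind
  simp only [hin.map_q] at hblock
  rw [← hblock, ← (hin.identDistrib_mt k).map_eq]
  exact hind.map_prod_eq_prod_map_map
    (measurable_pi_lambda _ fun _ => hin.measurable_q _).aemeasurable
    (hin.measurable_mt k).aemeasurable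

theorem isRandomRecursion_creditQueue (hin : A.IsInput μ q mt) (hQ₀ : Measurable Q₀)
    (hind : IndepFun Q₀ (fun ω => ((fun t => q t ω), (fun k => mt k ω))) μ) :
    IsRandomRecursion μ (sourceFiltration (hin.source_le hQ₀) A.sourceTime) (cycleStep sel)
      (μ.map (A.cycleNoise q mt 0)) (A.creditQueue sel q mt Q₀) (A.cycleNoise q mt) where
  measurable_state k := by
    have hle {s k} (hs : A.sourceTime s ≤ k) :
        source q mt Q₀ s ≤ sourceFiltration (hin.source_le hQ₀) A.sourceTime k :=
      le_sourceFiltration _ hs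
    induction k with
    | zero => exact (comap_measurable Q₀).mono (hle (s := Sum.inl ()) le_rfl) le_rfl
    | succ k ih =>
      have hnoise : Measurable[sourceFiltration (hin.source_le hQ₀) A.sourceTime (k + 1)]
          (A.cycleNoise q mt k) :=
        (comap_measurable _).mono ((comap_cycleNoise_le k).trans
          (iSup₂_le fun s hs => hle (Eq.le hs))) le_rfl
      rw [funext (creditQueue_succ q mt Q₀ k)]
      exact measurable_uncurry_cycleStep.comp
        ((ih.mono (Filtration.mono _ k.le_succ) le_rfl).prodMk hnoise)
  measurable_noise := hin.measurable_cycleNoise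
  indep_noise k := indep_of_indep_of_le_right
    (indep_sourceFiltration (hin.source_le hQ₀) (hin.iIndep_source hind) A.sourceTime k)
    (comap_cycleNoise_le k)
  map_noise k := by rw [hin.map_cycleNoise, hin.map_cycleNoise]
  state_succ := creditQueue_succ q mt Q₀

end IsInput

end Input

section Moments

variable {ι σ Kw Ω : Type*} [Fintype ι] [Fintype σ] [MeasurableSpace Ω] {A : CTRModel ι σ Kw}
  {μ : Measure Ω} {q : ℕ → Ω → Option Kw} {mt : ℕ → Ω → ι → ℕ}
  {sel : Kw → (ι → ℕ) → Matrix ι σ ℕ}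

/-- The expected number of impressions of client `i` in a cycle during which the queue lengths
are `x`. -/
noncomputable def meanImpressions (A : CTRModel ι σ Kw) (sel : Kw → (ι → ℕ) → Matrix ι σ ℕ)
    (x : ι → ℕ) (i : ι) : ℝ :=
  A.N * ∑' κ, A.rate κ * ∑ s, (sel κ x i s : ℝ)

lemma rate_nonneg (A : CTRModel ι σ Kw) (κ : Kw) : 0 ≤ A.rate κ :=
  mul_nonneg A.arrival_pos.le (A.θ_nonneg κ)

namespace IsInput

lemma measurable_mt_apply (hin : A.IsInput μ q mt) (k : ℕ) (i : ι) :
    Measurable fun ω => mt k ω i :=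
  (measurable_pi_apply i).comp (hin.measurable_mt k)

lemma ae_mt_le (hin : A.IsInput μ q mt) (k : ℕ) (i : ι) : ∀ᵐ ω ∂μ, mt k ω i ≤ ⌈A.m i⌉₊ := by
  have hdirac {a b : ℕ} (hab : a ≤ b) : ∀ᵐ n ∂(Measure.dirac a), n ≤ b := by
    rwa [ae_dirac_eq]
  have hlaw : ∀ᵐ n ∂(μ.map fun ω => mt k ω i), n ≤ ⌈A.m i⌉₊ := by
    rw [hin.law_mt, ae_add_measure_iff]
    exact ⟨Measure.ae_smul_measure (hdirac le_rfl) _,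
      Measure.ae_smul_measure (hdirac (Nat.floor_le_ceil _)) _⟩
  exact ae_of_ae_map (hin.measurable_mt_apply k i).aemeasurable hlaw

lemma integral_mt (hin : A.IsInput μ q mt) (k : ℕ) (i : ι) :
    ∫ ω, (mt k ω i : ℝ) ∂μ = A.m i := by
  have hfloor : (⌊A.m i⌋₊ : ℝ) ≤ A.m i := Nat.floor_le (A.m_nonneg i)
  have hfloor' : A.m i < ⌊A.m i⌋₊ + 1 := Nat.lt_floor_add_one _
  have hint (a : ℕ) (p : ℝ) :
      Integrable (fun n : ℕ => (n : ℝ)) (ENNReal.ofReal p • Measure.dirac a) :=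
    (integrable_dirac (by simp)).smul_measure ENNReal.ofReal_ne_top
  rw [← integral_map (φ := fun ω => mt k ω i) (f := fun n : ℕ => (n : ℝ))
      (hin.measurable_mt_apply k i).aemeasurable Measurable.of_discrete.aestronglyMeasurable,
    hin.law_mt, integral_add_measure (hint _ _) (hint _ _), integral_smul_measure,
    integral_smul_measure, integral_dirac, integral_dirac, ENNReal.toReal_ofReal (by linarith),
    ENNReal.toReal_ofReal (by linarith), smul_eq_mul, smul_eq_mul]
  rcases hfloor.eq_or_lt with heq | hlt
  · rw [← heq]
    simp
  · have hceil : ⌈A.m i⌉₊ = ⌊A.m i⌋₊ + 1 := by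
      rw [Nat.ceil_eq_iff (Nat.succ_ne_zero _)]
      exact ⟨by simpa using hlt, by exact_mod_cast hfloor'.le⟩
    rw [hceil]
    push_cast
    ring

variable [IsProbabilityMeasure μ]

lemma integrable_mt (hin : A.IsInput μ q mt) (k : ℕ) (i : ι) :
    Integrable (fun ω => (mt k ω i : ℝ)) μ :=
  integrable_natCast_of_ae_le (hin.measurable_mt_apply k i) (hin.ae_mt_le k i)

lemma integrable_slotImpressions (hin : A.IsInput μ q mt) (hsel : A.IsAdmissibleRule sel)
    (x : ι → ℕ) (i : ι) (t : ℕ) : Integrable (fun ω => (slotImpressions sel x i (q t ω) : ℝ)) μ :=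
  integrable_natCast_of_ae_le
    ((Measurable.of_discrete (f := slotImpressions sel x i)).comp (hin.measurable_q t))
    (ae_of_all _ fun ω => slotImpressions_le_one hsel x i (q t ω))

lemma integrable_blockImpressions (hin : A.IsInput μ q mt) (hsel : A.IsAdmissibleRule sel)
    (x : ι → ℕ) (i : ι) (k : ℕ) :
    Integrable (fun ω => (blockImpressions sel x i (A.cycleNoise q mt k ω).1 : ℝ)) μ := by
  simp only [blockImpressions, Nat.cast_sum]
  exact integrable_finsetSum _ fun j _ => hin.integrable_slotImpressions hsel x i _

variable [Countable Kw]

lemma integral_slotImpressions (hin : A.IsInput μ q mt) (hsel : A.IsAdmissibleRule sel)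
    (x : ι → ℕ) (i : ι) (t : ℕ) :
    ∫ ω, (slotImpressions sel x i (q t ω) : ℝ) ∂μ = ∑' κ, A.rate κ * ∑ s, (sel κ x i s : ℝ) := by
  have hq := (hin.measurable_q t).aemeasurable (μ := μ)
  have hmeas : AEStronglyMeasurable (fun o => (slotImpressions sel x i o : ℝ)) (μ.map (q t)) :=
    Measurable.of_discrete.aestronglyMeasurable
  rw [← integral_map hq hmeas, integral_countable
    ((integrable_map_measure hmeas hq).2 (hin.integrable_slotImpressions hsel x i t)),
    ← (Option.some_injective Kw).tsum_eq]
  · refine tsum_congr fun κ => ?_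
    have hprob : (μ.map (q t)).real {some κ} = A.rate κ := by
      rw [map_measureReal_apply (hin.measurable_q t) (measurableSet_singleton _), measureReal_def]
      exact (congrArg ENNReal.toReal (hin.prob_some t κ)).trans
        (ENNReal.toReal_ofReal (A.rate_nonneg κ))
    simp [hprob, slotImpressions]
  · rintro (_ | κ) ho
    · simp [slotImpressions] at ho
    · exact ⟨κ, rfl⟩

lemma integral_blockImpressions (hin : A.IsInput μ q mt) (hsel : A.IsAdmissibleRule sel)
    (x : ι → ℕ) (i : ι) (k : ℕ) :
    ∫ ω, (blockImpressions sel x i (A.cycleNoise q mt k ω).1 : ℝ) ∂μ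
      = A.meanImpressions sel x i := by
  simp only [blockImpressions, Nat.cast_sum, cycleNoise]
  rw [integral_finsetSum _ fun j _ => hin.integrable_slotImpressions hsel x i _]
  simp_rw [hin.integral_slotImpressions hsel]
  simp [meanImpressions]

end IsInput

end Moments

section MaxWeight

variable {ι σ Kw : Type*} [Fintype ι] [Fintype σ] (A : CTRModel ι σ Kw)

lemma hasSum_rate : HasSum A.rate A.arrival := by
  have h := A.θ_hasSum.mul_left A.arrival
  rwa [mul_one] at h

lemma summable_rate_mul {g : Kw → ℝ} (hg : ∀ κ, 0 ≤ g κ) (hg' : ∀ κ, g κ ≤ 1) :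
    Summable fun κ => A.rate κ * g κ :=
  .of_nonneg_of_le (fun κ => mul_nonneg (A.rate_nonneg κ) (hg κ))
    (fun κ => mul_le_of_le_one_right (A.rate_nonneg κ) (hg' κ)) A.hasSum_rate.summable

lemma row_sum_le_one {κ : Kw} {M : Matrix ι σ ℕ} (hM : M ∈ A.admissible κ) (i : ι) :
    ∑ s, (M i s : ℝ) ≤ 1 := by
  exact_mod_cast (A.admissible_isAssignment κ M hM).2.2 i

lemma weight_eq (κ : Kw) (x : ι → ℕ) (M : Matrix ι σ ℕ) :
    A.weight κ x M = ∑ i, (x i : ℝ) * ∑ s, (M i s : ℝ)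
      + ∑ i, ∑ s, (M i s : ℝ) * (A.c κ i s / A.ε) := by
  simp only [weight, mul_add, Finset.sum_add_distrib, Finset.mul_sum]
  rw [add_comm]
  simp only [mul_comm]

lemma sum_mul_row_sum_le_weight (κ : Kw) (x : ι → ℕ) (M : Matrix ι σ ℕ) :
    ∑ i, (x i : ℝ) * ∑ s, (M i s : ℝ) ≤ A.weight κ x M := by
  rw [weight_eq]
  exact le_add_of_nonneg_right (Finset.sum_nonneg fun i _ => Finset.sum_nonneg fun s _ =>
    mul_nonneg (Nat.cast_nonneg _) (div_nonneg (A.c_nonneg κ i s) A.ε_pos.le))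

lemma weight_le {κ : Kw} (x : ι → ℕ) {M : Matrix ι σ ℕ} (hM : M ∈ A.admissible κ) :
    A.weight κ x M ≤ ∑ i, (x i : ℝ) * ∑ s, (M i s : ℝ) + Fintype.card ι / A.ε := by
  rw [weight_eq]
  gcongr
  calc ∑ i, ∑ s, (M i s : ℝ) * (A.c κ i s / A.ε)
      ≤ ∑ i, (∑ s, (M i s : ℝ)) * (1 / A.ε) := by
        simp only [Finset.sum_mul]
        gcongr with i _ s _
        exacts [A.ε_pos.le, A.c_le_one κ i s]
    _ ≤ ∑ _i : ι, 1 / A.ε := Finset.sum_le_sum fun i _ =>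
        mul_le_of_le_one_left (one_div_nonneg.2 A.ε_pos.le) (A.row_sum_le_one hM i)
    _ = Fintype.card ι / A.ε := by
        rw [Finset.sum_const, Finset.card_univ, nsmul_eq_mul, mul_one_div]

variable {A} {p : Kw → Matrix ι σ ℕ → ℝ} {sel : Kw → (ι → ℕ) → Matrix ι σ ℕ}

lemma StrictlyFeasible.sum_mul_mean_row_sum_le (hp : A.StrictlyFeasible p)
    (hsel : A.IsMaxWeightRule sel) (κ : Kw) (x : ι → ℕ) :
    ∑ i, (x i : ℝ) * ∑ M ∈ A.admissible κ, p κ M * ∑ s, (M i s : ℝ)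
      ≤ ∑ i, (x i : ℝ) * ∑ s, (sel κ x i s : ℝ) + Fintype.card ι / A.ε := by
  have hweight : 0 ≤ A.weight κ x (sel κ x) :=
    (Finset.sum_nonneg fun i _ => by positivity).trans (A.sum_mul_row_sum_le_weight κ x _)
  calc ∑ i, (x i : ℝ) * ∑ M ∈ A.admissible κ, p κ M * ∑ s, (M i s : ℝ)
      = ∑ M ∈ A.admissible κ, p κ M * ∑ i, (x i : ℝ) * ∑ s, (M i s : ℝ) := by
        simp_rw [Finset.mul_sum (A.admissible κ)]
        rw [Finset.sum_comm]
        refine Finset.sum_congr rfl fun M _ => ?_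
        rw [Finset.mul_sum]
        exact Finset.sum_congr rfl fun i _ => mul_left_comm _ _ _
    _ ≤ ∑ M ∈ A.admissible κ, p κ M * A.weight κ x (sel κ x) :=
        Finset.sum_le_sum fun M hM => mul_le_mul_of_nonneg_left
          ((A.sum_mul_row_sum_le_weight κ x M).trans ((hsel κ x).2 M hM)) (hp.1 κ M hM).1
    _ = (∑ M ∈ A.admissible κ, p κ M) * A.weight κ x (sel κ x) := by rw [Finset.sum_mul]
    _ ≤ A.weight κ x (sel κ x) := mul_le_of_le_one_left hweight (hp.2.1 κ)
    _ ≤ _ := A.weight_le x (hsel κ x).1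

lemma hasSum_sum_mul_rate_mul {a : Kw → ι → ℝ} (ha : ∀ κ i, 0 ≤ a κ i) (ha' : ∀ κ i, a κ i ≤ 1)
    (w : ι → ℝ) :
    HasSum (fun κ => A.rate κ * ∑ i, w i * a κ i) (∑ i, w i * ∑' κ, A.rate κ * a κ i) := by
  have hsum := hasSum_sum (s := Finset.univ) fun i _ =>
    ((A.summable_rate_mul (fun κ => ha κ i) fun κ => ha' κ i).hasSum.mul_left (w i))
  simpa only [Finset.mul_sum, mul_left_comm] using hsum

lemma StrictlyFeasible.sum_mul_avgImpressions_le (hp : A.StrictlyFeasible p)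
    (hsel : A.IsMaxWeightRule sel) (x : ι → ℕ) :
    ∑ i, (x i : ℝ) * A.avgImpressions p i ≤ ∑ i, (x i : ℝ) * A.meanImpressions sel x i
      + A.N * (A.arrival * (Fintype.card ι / A.ε)) := by
  have hfeasible := A.hasSum_sum_mul_rate_mul
    (a := fun κ i => ∑ M ∈ A.admissible κ, p κ M * ∑ s, (M i s : ℝ))
    (fun κ i => Finset.sum_nonneg fun M hM => mul_nonneg (hp.1 κ M hM).1 (by positivity))
    (fun κ i => (Finset.sum_le_sum fun M hM => mul_le_of_le_one_right (hp.1 κ M hM).1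
      (A.row_sum_le_one hM i)).trans (hp.2.1 κ)) fun i => (x i : ℝ)
  have hmaxWeight := A.hasSum_sum_mul_rate_mul (a := fun κ i => ∑ s, (sel κ x i s : ℝ))
    (fun κ i => by positivity) (fun κ i => A.row_sum_le_one (hsel κ x).1 i) fun i => (x i : ℝ)
  have hle := hasSum_le (fun κ => mul_le_mul_of_nonneg_left (hp.sum_mul_mean_row_sum_le hsel κ x)
    (A.rate_nonneg κ)) hfeasible
    (by simpa only [mul_add] using hmaxWeight.add (A.hasSum_rate.mul_right _))
  have hN := mul_le_mul_of_nonneg_left hle (Nat.cast_nonneg (α := ℝ) A.N)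
  simpa only [avgImpressions, meanImpressions, mul_add, Finset.mul_sum, mul_left_comm (A.N : ℝ)]
    using hN

end MaxWeight

section Drift

variable {ι σ Kw Ω : Type*} [Fintype ι] [Fintype σ] [MeasurableSpace Ω]
  {A : CTRModel ι σ Kw} {μ : Measure Ω} {q : ℕ → Ω → Option Kw} {mt : ℕ → Ω → ι → ℕ}
  {sel : Kw → (ι → ℕ) → Matrix ι σ ℕ}

/-- The Lyapunov function of the chain of credit queues. -/
noncomputable def lyapunov (x : ι → ℕ) : ℝ≥0∞ := ENNReal.ofReal (∑ i, (x i : ℝ) ^ 2)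

/-- The part of the drift of the Lyapunov function that does not depend on the queue lengths. -/
noncomputable def driftConst (A : CTRModel ι σ Kw) : ℝ := ∑ i, ((⌈A.m i⌉₊ : ℝ) + A.N) ^ 2

lemma StrictlyFeasible.exists_finset_drift_le {p : Kw → Matrix ι σ ℕ → ℝ}
    (hp : A.StrictlyFeasible p) (hsel : A.IsMaxWeightRule sel) :
    ∃ B : Finset (ι → ℕ), ∀ x ∉ B,
      2 * ∑ i, (x i : ℝ) * (A.m i - A.meanImpressions sel x i) + A.driftConst ≤ -1 := by
  classical
  set gap : ι → ℝ := fun i => A.avgImpressions p i - A.m i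
  have hgap i : 0 < gap i := sub_pos.2 (hp.2.2 i)
  set C : ℝ := A.driftConst + 2 * (A.N * (A.arrival * (Fintype.card ι / A.ε))) + 1
  refine ⟨Fintype.piFinset fun i => Finset.Iic ⌈C / (2 * gap i)⌉₊, fun x hx => ?_⟩
  obtain ⟨i, hi⟩ : ∃ i, ⌈C / (2 * gap i)⌉₊ < x i := by
    simpa only [Fintype.mem_piFinset, Finset.mem_Iic, not_forall, not_le] using hx
  have hC : C ≤ 2 * ∑ i, x i * gap i := calc
    C ≤ x i * (2 * gap i) := (div_le_iff₀ (mul_pos two_pos (hgap i))).1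
      ((Nat.le_ceil _).trans (by exact_mod_cast hi.le))
    _ = 2 * (x i * gap i) := mul_left_comm _ _ _
    _ ≤ 2 * ∑ i, x i * gap i := by
      gcongr
      exact Finset.single_le_sum (f := fun i => x i * gap i)
        (fun j _ => mul_nonneg (Nat.cast_nonneg _) (hgap j).le) (Finset.mem_univ i)
  have hmaxWeight := hp.sum_mul_avgImpressions_le hsel x
  simp only [gap, mul_sub, Finset.sum_sub_distrib] at hC ⊢
  linarith

/-- The transition kernel of the Markov chain of credit queues. -/
noncomputable def queueKernel [Countable Kw] (A : CTRModel ι σ Kw)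
    (sel : Kw → (ι → ℕ) → Matrix ι σ ℕ) (μ : Measure Ω) (q : ℕ → Ω → Option Kw)
    (mt : ℕ → Ω → ι → ℕ) : Kernel (ι → ℕ) (ι → ℕ) :=
  recursionKernel (measurable_uncurry_cycleStep (sel := sel)) (μ.map (A.cycleNoise q mt 0))

namespace IsInput

lemma isProbabilityMeasure_map_cycleNoise [IsProbabilityMeasure μ] (hin : A.IsInput μ q mt) :
    IsProbabilityMeasure (μ.map (A.cycleNoise q mt 0)) :=
  Measure.isProbabilityMeasure_map (hin.measurable_cycleNoise 0).aemeasurable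

variable [Countable Kw]

lemma measurable_cycleStep_cycleNoise (hin : A.IsInput μ q mt) (x : ι → ℕ) :
    Measurable fun ω => cycleStep sel x (A.cycleNoise q mt 0 ω) :=
  (Measurable.of_discrete (f := cycleStep sel x)).comp (hin.measurable_cycleNoise 0)

variable [IsProbabilityMeasure μ]

lemma isMarkovKernel_queueKernel (hin : A.IsInput μ q mt) :
    IsMarkovKernel (A.queueKernel sel μ q mt) :=
  have := hin.isProbabilityMeasure_map_cycleNoise
  inferInstanceAs (IsMarkovKernel (recursionKernel _ _))

lemma stable_iff (hin : A.IsInput μ q mt) :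
    A.Stable μ sel q mt
      ↔ ∃ B : Finset (ι → ℕ), ∀ x, meanReturnTime (A.queueKernel sel μ q mt) B x ≠ ∞ := by
  have := hin.isProbabilityMeasure_map_cycleNoise
  refine exists_congr fun B => forall_congr' fun x => ?_
  have hrec := hin.isRandomRecursion_creditQueue (sel := sel) (Q₀ := fun _ => x) measurable_const
    (indepFun_const_left _ _)
  have hreturn := hrec.lintegral_returnTime measurable_uncurry_cycleStep (fun ω => rfl)
    B.measurableSet
  rw [queueKernel, ← hreturn, lt_top_iff_ne_top]
  rfl

lemma integrable_sq_cycleStep (hin : A.IsInput μ q mt) (x : ι → ℕ) (i : ι) :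
    Integrable (fun ω => (cycleStep sel x (A.cycleNoise q mt 0 ω) i : ℝ) ^ 2) μ := by
  simp_rw [← Nat.cast_pow]
  refine integrable_natCast_of_ae_le (C := (x i + ⌈A.m i⌉₊) ^ 2)
    (((measurable_pi_apply i).comp (hin.measurable_cycleStep_cycleNoise x)).pow_const 2) ?_
  filter_upwards [hin.ae_mt_le 0 i] with ω hω
  exact Nat.pow_le_pow_left ((Nat.sub_le _ _).trans (Nat.add_le_add_left hω _)) 2

lemma integral_sq_cycleStep_le (hin : A.IsInput μ q mt) (hsel : A.IsAdmissibleRule sel)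
    (x : ι → ℕ) (i : ι) :
    ∫ ω, (cycleStep sel x (A.cycleNoise q mt 0 ω) i : ℝ) ^ 2 ∂μ
      ≤ (x i : ℝ) ^ 2 + 2 * x i * (A.m i - A.meanImpressions sel x i)
        + ((⌈A.m i⌉₊ : ℝ) + A.N) ^ 2 := by
  set S : Ω → ℝ := fun ω => blockImpressions sel x i (A.cycleNoise q mt 0 ω).1
  have hS : Integrable S μ := hin.integrable_blockImpressions hsel x i 0
  have hdiff : Integrable (fun ω => 2 * x i * (mt 0 ω i - S ω)) μ :=
    ((hin.integrable_mt 0 i).sub hS).const_mul _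
  calc ∫ ω, (cycleStep sel x (A.cycleNoise q mt 0 ω) i : ℝ) ^ 2 ∂μ
      ≤ ∫ ω, (x i : ℝ) ^ 2 + 2 * x i * (mt 0 ω i - S ω) + ((⌈A.m i⌉₊ : ℝ) + A.N) ^ 2 ∂μ := by
        refine integral_mono_ae (hin.integrable_sq_cycleStep x i)
          (((integrable_const _).add hdiff).add (integrable_const _)) ?_
        filter_upwards [hin.ae_mt_le 0 i] with ω hω
        exact sq_tsub_le hω (blockImpressions_le hsel x i _)
    _ = _ := by
        rw [integral_add (by fun_prop) (by fun_prop), integral_add (by fun_prop) hdiff,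
          integral_const_mul,
          integral_sub (hin.integrable_mt 0 i) hS, hin.integral_mt,
          hin.integral_blockImpressions hsel]
        simp

lemma lintegral_lyapunov (hin : A.IsInput μ q mt) (x : ι → ℕ) :
    ∫⁻ y, lyapunov y ∂A.queueKernel sel μ q mt x
      = ENNReal.ofReal (∑ i, ∫ ω, (cycleStep sel x (A.cycleNoise q mt 0 ω) i : ℝ) ^ 2 ∂μ) := by
  rw [queueKernel, lintegral_recursionKernel _ _ Measurable.of_discrete,
    lintegral_map Measurable.of_discrete (hin.measurable_cycleNoise 0),
    ← integral_finsetSum _ fun i _ => hin.integrable_sq_cycleStep x i,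
    ofReal_integral_eq_lintegral_ofReal
      (integrable_finsetSum _ fun i _ => hin.integrable_sq_cycleStep x i)
      (ae_of_all _ fun ω => Finset.sum_nonneg fun i _ => sq_nonneg _)]
  rfl

lemma sum_integral_sq_cycleStep_le (hin : A.IsInput μ q mt) (hsel : A.IsAdmissibleRule sel)
    (x : ι → ℕ) :
    ∑ i, ∫ ω, (cycleStep sel x (A.cycleNoise q mt 0 ω) i : ℝ) ^ 2 ∂μ
      ≤ ∑ i, (x i : ℝ) ^ 2 + (2 * ∑ i, (x i : ℝ) * (A.m i - A.meanImpressions sel x i)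
        + A.driftConst) := by
  refine (Finset.sum_le_sum fun i _ => hin.integral_sq_cycleStep_le hsel x i).trans_eq ?_
  simp only [Finset.sum_add_distrib, driftConst, Finset.mul_sum, mul_assoc, add_assoc]

theorem stable_of_strictlyFeasible (hin : A.IsInput μ q mt) (hsel : A.IsMaxWeightRule sel)
    {p : Kw → Matrix ι σ ℕ → ℝ} (hp : A.StrictlyFeasible p) : A.Stable μ sel q mt := by
  have := hin.isMarkovKernel_queueKernel (sel := sel)
  obtain ⟨B, hB⟩ := hp.exists_finset_drift_le hsel
  refine hin.stable_iff.2 ⟨B, meanReturnTime_ne_top_of_foster_drift B.measurableSet (V := lyapunov)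
    (fun x => ?_) fun x hx => ?_⟩
  · rw [hin.lintegral_lyapunov]
    exact ENNReal.ofReal_ne_top
  · have hle := hin.sum_integral_sq_cycleStep_le hsel.isAdmissibleRule x
    rw [hin.lintegral_lyapunov, ← ENNReal.ofReal_one, ← ENNReal.ofReal_add
      (Finset.sum_nonneg fun i _ => integral_nonneg fun ω => sq_nonneg _) zero_le_one]
    exact ENNReal.ofReal_le_ofReal (by linarith [hB x hx])

end IsInput

end Drift

section Throughput

variable {ι σ Kw Ω : Type*} [Fintype ι] [Fintype σ] {A : CTRModel ι σ Kw}
  {q : ℕ → Ω → Option Kw} {mt : ℕ → Ω → ι → ℕ} {sel : Kw → (ι → ℕ) → Matrix ι σ ℕ}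
  {Q₀ : Ω → ι → ℕ}

lemma cycleImpressions_le (hsel : A.IsAdmissibleRule sel) (k : ℕ) (i : ι) (ω : Ω) :
    A.cycleImpressions sel q mt Q₀ k i ω ≤ A.N := by
  rw [cycleImpressions_eq_blockImpressions]
  exact blockImpressions_le hsel _ i _

lemma sum_Icc_mt_le (i : ι) (K : ℕ) (ω : Ω) :
    ∑ k ∈ Finset.Icc 1 K, mt k ω i ≤ A.creditQueue sel q mt Q₀ (K + 1) ω i
      + ∑ k ∈ Finset.Icc 1 K, A.cycleImpressions sel q mt Q₀ k i ω := by
  induction K with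
  | zero => exact Nat.zero_le _
  | succ K ih =>
    have hstep : A.creditQueue sel q mt Q₀ (K + 1) ω i + mt (K + 1) ω i
        - A.cycleImpressions sel q mt Q₀ (K + 1) i ω
        = A.creditQueue sel q mt Q₀ (K + 1 + 1) ω i := rfl
    rw [Finset.sum_Icc_succ_top (by omega), Finset.sum_Icc_succ_top (by omega)]
    omega

variable [MeasurableSpace Ω] {μ : Measure Ω}

namespace IsInput

lemma ae_sum_Icc_mt_le (hin : A.IsInput μ q mt) (i : ι) (K : ℕ) :
    ∀ᵐ ω ∂μ, ∑ k ∈ Finset.Icc 1 K, mt k ω i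
      ≤ min (A.creditQueue sel q mt Q₀ (K + 1) ω i) (K * ⌈A.m i⌉₊)
        + ∑ k ∈ Finset.Icc 1 K, A.cycleImpressions sel q mt Q₀ k i ω := by
  filter_upwards [ae_all_iff.2 fun k => hin.ae_mt_le k i] with ω hω
  have hsum : ∑ k ∈ Finset.Icc 1 K, mt k ω i ≤ K * ⌈A.m i⌉₊ :=
    (Finset.sum_le_card_nsmul _ _ _ fun k _ => hω k).trans_eq (by simp)
  have hqueue := sum_Icc_mt_le (A := A) (sel := sel) (q := q) (mt := mt) (Q₀ := Q₀) i K ω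
  omega

variable [IsProbabilityMeasure μ] [Countable Kw]

lemma norm_meanImpressions_le (hin : A.IsInput μ q mt) (hsel : A.IsAdmissibleRule sel)
    (x : ι → ℕ) (i : ι) : ‖A.meanImpressions sel x i‖ ≤ A.N := by
  rw [← hin.integral_blockImpressions hsel x i 0]
  refine (norm_integral_le_of_norm_le_const (C := A.N) (ae_of_all _ fun ω => ?_)).trans_eq (by simp)
  simpa using blockImpressions_le hsel x i _

variable (hin : A.IsInput μ q mt) (hQ₀ : Measurable Q₀)
  (hind : IndepFun Q₀ (fun ω => ((fun t => q t ω), (fun k => mt k ω))) μ)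
include hin hQ₀ hind

lemma measurable_creditQueue (k : ℕ) :
    Measurable (A.creditQueue sel q mt Q₀ k) :=
  (hin.isRandomRecursion_creditQueue hQ₀ hind).measurable k

lemma integrable_cycleImpressions (hsel : A.IsAdmissibleRule sel) (i : ι) (k : ℕ) :
    Integrable (fun ω => (A.cycleImpressions sel q mt Q₀ k i ω : ℝ)) μ := by
  refine integrable_natCast_of_ae_le ?_ (ae_of_all _ fun ω => cycleImpressions_le hsel k i ω)
  rw [funext (cycleImpressions_eq_blockImpressions q mt Q₀ k i)]
  exact (Measurable.of_discrete (f := fun y : (ι → ℕ) × (Fin A.N → Option Kw) =>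
    blockImpressions sel y.1 i y.2)).comp
      ((measurable_creditQueue hin hQ₀ hind k).prodMk (hin.measurable_cycleNoise k).fst)

lemma integral_cycleImpressions (hsel : A.IsAdmissibleRule sel) (i : ι) (k : ℕ) :
    ∫ ω, (A.cycleImpressions sel q mt Q₀ k i ω : ℝ) ∂μ
      = ∫ x, A.meanImpressions sel x i ∂μ.map (A.creditQueue sel q mt Q₀ k) := by
  have := hin.isProbabilityMeasure_map_cycleNoise
  have hqueue := measurable_creditQueue (sel := sel) hin hQ₀ hind k
  have := Measure.isProbabilityMeasure_map (μ := μ) hqueue.aemeasurable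
  set F : (ι → ℕ) × (Fin A.N → Option Kw) × (ι → ℕ) → ℝ :=
    fun y => blockImpressions sel y.1 i y.2.1
  have hF : Measurable F := Measurable.of_discrete
  calc ∫ ω, (A.cycleImpressions sel q mt Q₀ k i ω : ℝ) ∂μ
      = ∫ ω, F (A.creditQueue sel q mt Q₀ k ω, A.cycleNoise q mt k ω) ∂μ := by
        simp_rw [cycleImpressions_eq_blockImpressions, F]
    _ = ∫ y, F y ∂(μ.map (A.creditQueue sel q mt Q₀ k)).prod (μ.map (A.cycleNoise q mt 0)) := by
        rw [← (hin.isRandomRecursion_creditQueue hQ₀ hind).map_prodMk k, integral_map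
          (hqueue.prodMk (hin.measurable_cycleNoise k)).aemeasurable hF.aestronglyMeasurable]
    _ = ∫ x, ∫ e, F (x, e) ∂μ.map (A.cycleNoise q mt 0) ∂μ.map (A.creditQueue sel q mt Q₀ k) :=
        integral_prod _ (integrable_natCast_of_ae_le .of_discrete
          (ae_of_all _ fun y => blockImpressions_le hsel _ i _))
    _ = _ := by
        congr with x
        rw [integral_map (hin.measurable_cycleNoise 0).aemeasurable
          (Measurable.of_discrete (f := fun e => F (x, e))).aestronglyMeasurable]
        exact hin.integral_blockImpressions hsel x i 0

lemma mul_m_le_integral_min_add_sum (hsel : A.IsAdmissibleRule sel) (i : ι) (K : ℕ) :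
    K * A.m i ≤ ∫ ω, ((min (A.creditQueue sel q mt Q₀ (K + 1) ω i) (K * ⌈A.m i⌉₊) : ℕ) : ℝ) ∂μ
      + ∑ k ∈ Finset.Icc 1 K, ∫ ω, (A.cycleImpressions sel q mt Q₀ k i ω : ℝ) ∂μ := by
  have hS k := integrable_cycleImpressions hin hQ₀ hind hsel i k
  have hmin : Integrable
      (fun ω => ((min (A.creditQueue sel q mt Q₀ (K + 1) ω i) (K * ⌈A.m i⌉₊) : ℕ) : ℝ)) μ :=
    integrable_natCast_of_ae_le (((measurable_pi_apply i).comp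
      (measurable_creditQueue hin hQ₀ hind (K + 1))).min measurable_const)
      (ae_of_all _ fun ω => min_le_right _ _)
  calc K * A.m i = ∫ ω, ∑ k ∈ Finset.Icc 1 K, (mt k ω i : ℝ) ∂μ := by
        rw [integral_finsetSum _ fun k _ => hin.integrable_mt k i]
        simp [hin.integral_mt]
    _ ≤ ∫ ω, ((min (A.creditQueue sel q mt Q₀ (K + 1) ω i) (K * ⌈A.m i⌉₊) : ℕ) : ℝ)
          + ∑ k ∈ Finset.Icc 1 K, (A.cycleImpressions sel q mt Q₀ k i ω : ℝ) ∂μ := by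
        refine integral_mono_ae (integrable_finsetSum _ fun k _ => hin.integrable_mt k i)
          (hmin.add (integrable_finsetSum _ fun k _ => hS k)) ?_
        filter_upwards [hin.ae_sum_Icc_mt_le (sel := sel) (Q₀ := Q₀) i K] with ω hω
        exact_mod_cast hω
    _ = _ := by
        rw [integral_add hmin (integrable_finsetSum _ fun k _ => hS k),
          integral_finsetSum _ fun k _ => hS k]

lemma map_creditQueue_succ (k : ℕ) :
    μ.map (A.creditQueue sel q mt Q₀ (k + 1))
      = (μ.map (A.creditQueue sel q mt Q₀ k)).bind (A.queueKernel sel μ q mt) :=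
  have := hin.isProbabilityMeasure_map_cycleNoise
  (hin.isRandomRecursion_creditQueue hQ₀ hind).map_succ measurable_uncurry_cycleStep k

lemma isTightMeasureSet_law_creditQueue (hstable : A.Stable μ sel q mt) :
    IsTightMeasureSet (Set.range fun k => μ.map (A.creditQueue sel q mt Q₀ k)) := by
  have := hin.isMarkovKernel_queueKernel (sel := sel)
  have (k : ℕ) := Measure.isProbabilityMeasure_map (μ := μ)
    (hin.measurable_creditQueue (sel := sel) hQ₀ hind k).aemeasurable
  obtain ⟨B, hB⟩ := hin.stable_iff.1 hstable
  exact isTightMeasureSet_range_law (hin.map_creditQueue_succ hQ₀ hind) hB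

lemma isTightMeasureSet_law_creditQueue_succ_apply (hstable : A.Stable μ sel q mt) (i : ι) :
    IsTightMeasureSet
      (Set.range fun k => μ.map fun ω => A.creditQueue sel q mt Q₀ (k + 1) ω i) := by
  refine ((hin.isTightMeasureSet_law_creditQueue hQ₀ hind hstable).map
    (continuous_apply i)).subset ?_
  rintro _ ⟨k, rfl⟩
  exact ⟨_, ⟨k + 1, rfl⟩, Measure.map_map (measurable_pi_apply i)
    (hin.measurable_creditQueue hQ₀ hind (k + 1))⟩

lemma integral_average_cycleImpressions (hsel : A.IsAdmissibleRule sel) (i : ι) (K : ℕ) :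
    ∫ ω, (1 / (K : ℝ)) *
        ∑ k ∈ Finset.Icc 1 K, (A.cycleImpressions sel q mt Q₀ k i ω : ℝ) ∂μ
      = (K : ℝ)⁻¹ *
        ∑ k ∈ Finset.Icc 1 K, ∫ ω, (A.cycleImpressions sel q mt Q₀ k i ω : ℝ) ∂μ := by
  rw [integral_const_mul, one_div,
    integral_finsetSum _ fun k _ => hin.integrable_cycleImpressions hQ₀ hind hsel i k]

theorem exists_tendsto_average_cycleImpressions (hsel : A.IsAdmissibleRule sel)
    (hstable : A.Stable μ sel q mt) (i : ι) :
    ∃ l : ℝ, Tendsto (fun K : ℕ => ∫ ω, (1 / (K : ℝ)) *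
      ∑ k ∈ Finset.Icc 1 K, (A.cycleImpressions sel q mt Q₀ k i ω : ℝ) ∂μ) atTop (𝓝 l) := by
  have := hin.isMarkovKernel_queueKernel (sel := sel)
  have (k : ℕ) := Measure.isProbabilityMeasure_map (μ := μ)
    (hin.measurable_creditQueue (sel := sel) hQ₀ hind k).aemeasurable
  have htight : IsTightMeasureSet
      (Set.range fun k => μ.map (A.creditQueue sel q mt Q₀ (k + 1))) :=
    (hin.isTightMeasureSet_law_creditQueue hQ₀ hind hstable).subset
      (Set.range_comp_subset_range (· + 1) fun k => μ.map (A.creditQueue sel q mt Q₀ k))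
  obtain ⟨l, hl⟩ := exists_tendsto_average_integral (A.queueKernel sel μ q mt)
    (law := fun k => μ.map (A.creditQueue sel q mt Q₀ (k + 1)))
    (fun k => hin.map_creditQueue_succ hQ₀ hind (k + 1)) htight
    fun x => hin.norm_meanImpressions_le hsel x i
  refine ⟨l, hl.congr fun K => ?_⟩
  rw [hin.integral_average_cycleImpressions hQ₀ hind hsel, Finset.range_eq_Ico,
    Finset.sum_Ico_add' (fun k => ∫ x, A.meanImpressions sel x i
      ∂μ.map (A.creditQueue sel q mt Q₀ k)), zero_add, Finset.Ico_add_one_right_eq_Icc]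
  simp only [hin.integral_cycleImpressions hQ₀ hind hsel]

lemma le_of_tendsto_average_cycleImpressions (hsel : A.IsAdmissibleRule sel)
    (hstable : A.Stable μ sel q mt) {i : ι} {l : ℝ}
    (hl : Tendsto (fun K : ℕ => ∫ ω, (1 / (K : ℝ)) *
      ∑ k ∈ Finset.Icc 1 K, (A.cycleImpressions sel q mt Q₀ k i ω : ℝ) ∂μ) atTop (𝓝 l)) :
    A.m i ≤ l := by
  have hmin := tendsto_inv_mul_integral_min
    (fun k => (measurable_pi_apply i).comp
      (hin.measurable_creditQueue (sel := sel) hQ₀ hind (k + 1)))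
    (hin.isTightMeasureSet_law_creditQueue_succ_apply hQ₀ hind hstable i) ⌈A.m i⌉₊
  rw [← zero_add l]
  refine ge_of_tendsto (hmin.add hl) ?_
  filter_upwards [eventually_gt_atTop 0] with K hK
  rw [hin.integral_average_cycleImpressions hQ₀ hind hsel, ← mul_add,
    le_inv_mul_iff₀ (Nat.cast_pos.2 hK)]
  exact hin.mul_m_le_integral_min_add_sum hQ₀ hind hsel i K

end IsInput

end Throughput

end CTRModel

theorem mainTheorem7_general {ι σ Kw Ω : Type*} [Fintype ι] [Fintype σ] [Countable Kw]
    [MeasurableSpace Ω] (μ : Measure Ω) [IsProbabilityMeasure μ] (A : CTRModel ι σ Kw)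
    (sel : Kw → (ι → ℕ) → Matrix ι σ ℕ) (hadm : A.IsAdmissibleRule sel)
    (q : ℕ → Ω → Option Kw) (mt : ℕ → Ω → ι → ℕ) (hin : A.IsInput μ q mt) :
    (A.IsMaxWeightRule sel → (∃ p, A.StrictlyFeasible p) → A.Stable μ sel q mt) ∧
    (A.Stable μ sel q mt →
      ∀ Q₀ : Ω → ι → ℕ, Measurable Q₀ →
        IndepFun Q₀ (fun ω => ((fun t => q t ω), (fun k => mt k ω))) μ →
        ∀ i, ∃ l : ℝ,
          Tendsto (fun K : ℕ => ∫ ω, (1 / (K : ℝ)) *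
            ∑ k ∈ Finset.Icc 1 K, (A.cycleImpressions sel q mt Q₀ k i ω : ℝ) ∂μ) atTop (𝓝 l) ∧
          A.m i ≤ l) := by
  refine ⟨fun hsel ⟨p, hp⟩ => hin.stable_of_strictlyFeasible hsel hp,
    fun hstable Q₀ hQ₀ hind i => ?_⟩
  obtain ⟨l, hl⟩ := hin.exists_tendsto_average_cycleImpressions hQ₀ hind hadm hstable i
  exact ⟨l, hl, hin.le_of_tendsto_average_cycleImpressions hQ₀ hind hadm hstable hl⟩

theorem mainTheorem7 {ι σ Kw Ω : Type*} [Fintype ι] [Fintype σ] [Countable Kw] [MeasurableSpace Ω]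
    (μ : Measure Ω) [IsProbabilityMeasure μ] (A : CTRModel ι σ Kw)
    (sel : Kw → (ι → ℕ) → Matrix ι σ ℕ) (hsel : A.IsMaxWeightRule sel)
    (q : ℕ → Ω → Option Kw) (mt : ℕ → Ω → ι → ℕ) (hin : A.IsInput μ q mt) :
    ((∃ p, A.StrictlyFeasible p) → A.Stable μ sel q mt) ∧
    (A.Stable μ sel q mt →
      ∀ Q₀ : Ω → ι → ℕ, Measurable Q₀ →
        IndepFun Q₀ (fun ω => ((fun t => q t ω), (fun k => mt k ω))) μ →
        ∀ i, ∃ l : ℝ,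
          Tendsto (fun K : ℕ => ∫ ω, (1 / (K : ℝ)) *
            ∑ k ∈ Finset.Icc 1 K, (A.cycleImpressions sel q mt Q₀ k i ω : ℝ) ∂μ) atTop (𝓝 l) ∧
          A.m i ≤ l) := by
  obtain ⟨hstability, hthroughput⟩ := mainTheorem7_general μ A sel hsel.isAdmissibleRule q mt hin
  exact ⟨hstability hsel, hthroughput⟩
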